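/- Let $k$ be an algebraically closed field, $n\ge 1$, and let $X$ be an irreducible algebraic variety over $k$ on which the algebraic group $\mathrm{PGL}_n$ acts freely, with quotient variety $X/\mathrm{PGL}_n$ (so that $X\to X/\mathrm{PGL}_n$ is a principal $\mathrm{PGL}_n$-bundle). For an integer $w$, a vector bundle of weight $w$ over $X$ is a vector bundle over $X$ with a fibrewise linear action of $\mathrm{GL}_n$ that lifts the action of $\mathrm{PGL}_n$ on $X$ and in which each scalar matrix $t\cdot I$ acts on the fibres as multiplication by $t^w$. For such a bundle $P$ let $\mathrm{Gr}_j(P)\to X$ be the bundle of Grassmannians of $j$-dimensional subspaces of the fibres of $P$; $\mathrm{PGL}_n$ acts freely on it, and we write $\mathrm{Gr}_j(P)/\mathrm{PGL}_n\to X/\mathrm{PGL}_n$ for the quotient variety with its induced projection. A rational map $\rho\colon V\dashrightarrow W$ between irreducible varieties is called birationally linear if it is dominant and its generic fibre is rational, that is, the function field $k(V)$ is purely transcendental over the subfield $\rho^*k(W)$. Lemma. Let $P$ and $Q$ be vector bundles over $X$ of constant ranks $\mathrm{rk}\,P$ and $\mathrm{rk}\,Q$ and of the same weight $w$, and suppose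 that $j<\mathrm{rk}\,Q<\mathrm{rk}\,P$, where $j\ge 0$ is an integer. Then there is a birationally linear rational map $$\rho\colon \mathrm{Gr}_j(P)/\mathrm{PGL}_n\dashrightarrow \mathrm{Gr}_j(Q)/\mathrm{PGL}_n$$ compatible with the projections to $X/\mathrm{PGL}_n$; that is, the composite of $\rho$ with the projection $\mathrm{Gr}_j(Q)/\mathrm{PGL}_n\to X/\mathrm{PGL}_n$ equals the projection $\mathrm{Gr}_j(P)/\mathrm{PGL}_n\to X/\mathrm{PGL}_n$ as a rational map. -/

import Mathlib

open CategoryTheory AlgebraicGeometry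

universe u

noncomputable section

namespace PGLBundle

/-! ### Linear algebra along a ring homomorphism -/

/-- A semilinear map `β : M → N` along `σ : R → S` is a base change if it induces an isomorphism
`S ⊗[R] M ≃ N`. -/
def IsSemilinearBaseChange {R S M N : Type u} [CommRing R] [CommRing S] [AddCommGroup M]
    [AddCommGroup N] [Module R M] [Module S N] (σ : R →+* S) (β : M →ₛₗ[σ] N) : Prop :=
  letI : Algebra R S := σ.toAlgebra
  letI : Module R N := Module.compHom N σ
  haveI : IsScalarTower R S N := ⟨fun r s v => mul_smul (σ r) s v⟩
  IsBaseChange S ({ toFun := β, map_add' := β.map_add, map_smul' := fun r v => β.map_smulₛₗ r v } :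
    M →ₗ[R] N)

/-- The quotient of the base change `N` of `M` by the submodule generated by a submodule `L` of `M`
is the base change of `M ⧸ L`. -/
theorem IsSemilinearBaseChange.exists_quotient_equiv {R S M N : Type u} [CommRing R] [CommRing S]
    [AddCommGroup M] [AddCommGroup N] [Module R M] [Module S N] {σ : R →+* S} {β : M →ₛₗ[σ] N}
    (hβ : IsSemilinearBaseChange σ β) (L : Submodule R M) :
    letI : Algebra R S := σ.toAlgebra
    Nonempty (TensorProduct R S (M ⧸ L) ≃ₗ[S] (N ⧸ Submodule.span S (β '' (L : Set M)))) := by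
  let : Algebra R S := σ.toAlgebra
  let : Module R N := Module.compHom N σ
  have : IsScalarTower R S N := ⟨fun r s v => mul_smul (σ r) s v⟩
  let b : M →ₗ[R] N :=
    { toFun := β, map_add' := β.map_add, map_smul' := fun r v => β.map_smulₛₗ r v }
  have hb : IsBaseChange S b := hβ
  let e : TensorProduct R S M ≃ₗ[S] N := hb.equiv
  let π : TensorProduct R S M →ₗ[S] TensorProduct R S (M ⧸ L) := L.mkQ.baseChange S
  have hπ : Function.Surjective π := LinearMap.baseChange_surjective S L.mkQ_surjective
  have hker : LinearMap.ker π = Submodule.baseChange S L := by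
    have h := lTensor_exact S (f := L.subtype) (g := L.mkQ)
      (by rw [LinearMap.exact_iff]; simp) L.mkQ_surjective
    ext t
    have ht := h t
    exact ht
  have hmap : (LinearMap.ker π).map (e : TensorProduct R S M →ₗ[S] N)
      = Submodule.span S (β '' (L : Set M)) := by
    rw [hker, Submodule.baseChange_eq_span, Submodule.map_span, Submodule.map_coe, Set.image_image]
    congr 1
    refine Set.image_congr fun v _ => ?_
    exact (hb.equiv_tmul 1 v).trans (one_smul S (b v))
  exact ⟨(π.quotKerEquivOfSurjective hπ).symm ≪≫ₗ Submodule.Quotient.equiv _ _ e hmap⟩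

theorem span_image_span {R S M N : Type u} [CommRing R] [CommRing S] [AddCommGroup M]
    [AddCommGroup N] [Module R M] [Module S N] {σ : R →+* S} (β : M →ₛₗ[σ] N) (s : Set M) :
    Submodule.span S (β '' (Submodule.span R s : Set M)) = Submodule.span S (β '' s) := by
  refine le_antisymm (Submodule.span_le.2 ?_)
    (Submodule.span_mono (Set.image_mono Submodule.subset_span))
  rintro _ ⟨v, hv, rfl⟩
  induction hv using Submodule.span_induction with
  | mem v hv => exact Submodule.subset_span ⟨v, hv, rfl⟩
  | zero => rw [map_zero]; exact Submodule.zero_mem _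
  | add a b _ _ ha hb => rw [map_add]; exact Submodule.add_mem _ ha hb
  | smul c a _ ha => rw [map_smulₛₗ]; exact Submodule.smul_mem _ _ ha

/-- Pull-back of points of the Grassmannian along a base change: `L` goes to the submodule
generated by its image. -/
def grassmannianMap {R S M N : Type u} [CommRing R] [CommRing S] [AddCommGroup M] [AddCommGroup N]
    [Module R M] [Module S N] {σ : R →+* S} {β : M →ₛₗ[σ] N} (hβ : IsSemilinearBaseChange σ β)
    {c : ℕ} (L : Module.Grassmannian R M c) : Module.Grassmannian S N c where
  toSubmodule := Submodule.span S (β '' (L.toSubmodule : Set M))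
  finite_quotient := by
    let : Algebra R S := σ.toAlgebra
    obtain ⟨e⟩ := hβ.exists_quotient_equiv L.toSubmodule
    exact Module.Finite.equiv e
  projective_quotient := by
    let : Algebra R S := σ.toAlgebra
    obtain ⟨e⟩ := hβ.exists_quotient_equiv L.toSubmodule
    exact Module.Projective.of_equiv e
  rankAtStalk_eq p := by
    let : Algebra R S := σ.toAlgebra
    obtain ⟨e⟩ := hβ.exists_quotient_equiv L.toSubmodule
    rw [← Module.rankAtStalk_eq_of_equiv e, Module.rankAtStalk_baseChange]
    exact L.rankAtStalk_eq _

/-- Transport of points of the Grassmannian along a linear isomorphism. -/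
def grassmannianEquiv {R M N : Type u} [CommRing R] [AddCommGroup M] [AddCommGroup N]
    [Module R M] [Module R N] (e : M ≃ₗ[R] N) {c : ℕ} (L : Module.Grassmannian R M c) :
    Module.Grassmannian R N c where
  toSubmodule := L.toSubmodule.map (e : M →ₗ[R] N)
  finite_quotient := Module.Finite.equiv (Submodule.Quotient.equiv L.toSubmodule _ e rfl)
  projective_quotient :=
    Module.Projective.of_equiv (Submodule.Quotient.equiv L.toSubmodule _ e rfl)
  rankAtStalk_eq p := by
    rw [← Module.rankAtStalk_eq_of_equiv (Submodule.Quotient.equiv L.toSubmodule _ e rfl)]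
    exact L.rankAtStalk_eq p

/-! ### Varieties and their functors of points -/

variable {k : Type u} [Field k]

variable (k) in
/-- An irreducible algebraic variety over `k`: an integral separated scheme of finite type. -/
class IsVariety (X : Scheme.{u}) [X.Over (Spec (.of k))] : Prop where
  isIntegral : IsIntegral X
  isSeparated : IsSeparated (X ↘ Spec (.of k))
  locallyOfFiniteType : LocallyOfFiniteType (X ↘ Spec (.of k))
  quasiCompact : QuasiCompact (X ↘ Spec (.of k))

attribute [instance] IsVariety.isIntegral IsVariety.isSeparated IsVariety.locallyOfFiniteType
  IsVariety.quasiCompact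

variable (k) in
/-- The functor of points of a `k`-scheme `X`: it sends a `k`-algebra `R` to the set `X(R)` of
`k`-morphisms `Spec R ⟶ X`. -/
def points (X : Scheme.{u}) [X.Over (Spec (.of k))] : CommAlgCat.{u} k ⥤ Type u where
  obj R := { x : Spec (.of R) ⟶ X //
    x ≫ X ↘ Spec (.of k) = Spec.map (CommRingCat.ofHom (algebraMap k R)) }
  map {R R'} f := TypeCat.ofHom fun x => ⟨Spec.map (CommRingCat.ofHom f.hom.toRingHom) ≫ x.1, by
    rw [Category.assoc, x.2, ← Spec.map_comp, ← CommRingCat.ofHom_comp]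
    congr 2
    exact f.hom.comp_algebraMap⟩
  map_id R := by
    refine ConcreteCategory.hom_ext _ _ fun x => Subtype.ext ?_
    change Spec.map (𝟙 (CommRingCat.of R)) ≫ x.1 = x.1
    rw [Spec.map_id, Category.id_comp]
  map_comp {R R' R''} f g := by
    refine ConcreteCategory.hom_ext _ _ fun x => Subtype.ext ?_
    change Spec.map (CommRingCat.ofHom f.hom.toRingHom ≫ CommRingCat.ofHom g.hom.toRingHom) ≫ x.1
      = Spec.map (CommRingCat.ofHom g.hom.toRingHom) ≫ Spec.map (CommRingCat.ofHom f.hom.toRingHom)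
        ≫ x.1
    rw [Spec.map_comp, Category.assoc]

variable (k) in
/-- The map induced on points by a morphism of `k`-schemes. -/
def pointsMap {X Y : Scheme.{u}} [X.Over (Spec (.of k))] [Y.Over (Spec (.of k))] (f : X ⟶ Y)
    [f.IsOver (Spec (.of k))] : points k X ⟶ points k Y where
  app R := TypeCat.ofHom fun x => ⟨x.1 ≫ f, by rw [Category.assoc, comp_over, x.2]⟩
  naturality R R' g := by
    ext x
    exact Subtype.ext (Category.assoc _ _ _)

/-! ### Actions of `PGL_n` -/

/-- An action of the algebraic group `PGL_n = GL_n / 𝔾_m` on a `k`-functor: a functorial action of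
the groups `GL_n(R)` for which the scalar matrices act trivially. -/
class PGLAction (n : ℕ) (F : CommAlgCat.{u} k ⥤ Type u) where
  smul {R : CommAlgCat.{u} k} : GL (Fin n) R → F.obj R → F.obj R
  one_smul {R : CommAlgCat.{u} k} (x : F.obj R) : smul 1 x = x
  mul_smul {R : CommAlgCat.{u} k} (g h : GL (Fin n) R) (x : F.obj R) :
    smul (g * h) x = smul g (smul h x)
  map_smul {R R' : CommAlgCat.{u} k} (f : R ⟶ R') (g : GL (Fin n) R) (x : F.obj R) :
    F.map f (smul g x) = smul (Matrix.GeneralLinearGroup.map f.hom.toRingHom g) (F.map f x)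
  scalar_smul {R : CommAlgCat.{u} k} (t : Rˣ) (x : F.obj R) :
    smul (Matrix.GeneralLinearGroup.scalar (Fin n) t) x = x

/-- `q : F ⟶ Z` exhibits the `k`-scheme `Z` as the quotient `F / PGL_n` by a free action of `PGL_n`;
in other words `q` is a principal `PGL_n`-bundle:
* `q` is invariant;
* the action is free: the stabilizers in `GL_n` consist of scalar matrices only;
* two points of `F` with the same image differ by an element of `PGL_n(R)`, that is, by elements of
  `GL_n` Zariski-locally on `Spec R`;
* every point of `Z` lifts to `F` locally for the fppf topology. -/
structure IsPGLQuotient (n : ℕ) {F : CommAlgCat.{u} k ⥤ Type u} [PGLAction n F] {Z : Scheme.{u}}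
    [Z.Over (Spec (.of k))] (q : F ⟶ points k Z) : Prop where
  invariant {R : CommAlgCat.{u} k} (g : GL (Fin n) R) (x : F.obj R) :
    q.app R (PGLAction.smul g x) = q.app R x
  free {R : CommAlgCat.{u} k} (g : GL (Fin n) R) (x : F.obj R) (h : PGLAction.smul g x = x) :
    ∃ t : Rˣ, g = Matrix.GeneralLinearGroup.scalar (Fin n) t
  transitive {R : CommAlgCat.{u} k} (x y : F.obj R) (h : q.app R x = q.app R y) :
    ∃ s : Set R, Ideal.span s = ⊤ ∧ ∀ a ∈ s,
      ∃ g : GL (Fin n) (CommAlgCat.of k (Localization.Away a)),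
        PGLAction.smul g (F.map (CommAlgCat.ofHom (IsScalarTower.toAlgHom k R _)) x) =
          F.map (CommAlgCat.ofHom (IsScalarTower.toAlgHom k R _)) y
  locally_surjective {R : CommAlgCat.{u} k} (z : (points k Z).obj R) :
    ∃ (R' : CommAlgCat.{u} k) (f : R ⟶ R') (x : F.obj R'), f.hom.toRingHom.FaithfullyFlat ∧
      f.hom.toRingHom.FinitePresentation ∧ q.app R' x = (points k Z).map f z

/-! ### Vector bundles -/

/-- A vector bundle of rank `r` over a `k`-functor `F`, for instance over a `k`-scheme: a finitely
generated projective `R`-module of rank `r` for each `k`-algebra `R` and each `x ∈ F(R)` (the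
sections of the pull-back of the bundle along `x : Spec R ⟶ F`), compatible with base change. -/
structure VectorBundle (F : CommAlgCat.{u} k ⥤ Type u) (r : ℕ) where
  fiber {R : CommAlgCat.{u} k} (x : F.obj R) : Type u
  [addCommGroup {R : CommAlgCat.{u} k} (x : F.obj R) : AddCommGroup (fiber x)]
  [module {R : CommAlgCat.{u} k} (x : F.obj R) : Module R (fiber x)]
  [finite {R : CommAlgCat.{u} k} (x : F.obj R) : Module.Finite R (fiber x)]
  [projective {R : CommAlgCat.{u} k} (x : F.obj R) : Module.Projective R (fiber x)]
  rank_eq {R : CommAlgCat.{u} k} (x : F.obj R) (p : PrimeSpectrum R) :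
    Module.rankAtStalk (R := R) (fiber x) p = r
  /-- Pull-back of sections. -/
  pull {R R' : CommAlgCat.{u} k} (f : R ⟶ R') (x : F.obj R) (y : F.obj R') (h : F.map f x = y) :
    fiber x →ₛₗ[f.hom.toRingHom] fiber y
  isBaseChange {R R' : CommAlgCat.{u} k} (f : R ⟶ R') (x : F.obj R) (y : F.obj R')
    (h : F.map f x = y) : IsSemilinearBaseChange f.hom.toRingHom (pull f x y h)
  pull_id {R : CommAlgCat.{u} k} (x : F.obj R) (h : F.map (𝟙 R) x = x) (v : fiber x) :
    pull (𝟙 R) x x h v = v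
  pull_comp {R R' R'' : CommAlgCat.{u} k} (f : R ⟶ R') (g : R' ⟶ R'') (x : F.obj R) (y : F.obj R')
    (z : F.obj R'') (hf : F.map f x = y) (hg : F.map g y = z) (hfg : F.map (f ≫ g) x = z)
    (v : fiber x) : pull (f ≫ g) x z hfg v = pull g y z hg (pull f x y hf v)

attribute [instance] VectorBundle.addCommGroup VectorBundle.module VectorBundle.finite
  VectorBundle.projective

/-- A vector bundle of weight `w`: an action of `GL_n`, linear on the fibres, which lifts the action
of `PGL_n` on the base and in which the scalars `t` act on the fibres as multiplication by
`t ^ w`. -/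
structure WeightedBundle (n : ℕ) (w : ℤ) (F : CommAlgCat.{u} k ⥤ Type u) [PGLAction n F] (r : ℕ)
    extends VectorBundle F r where
  act {R : CommAlgCat.{u} k} (g : GL (Fin n) R) (x y : F.obj R) (h : PGLAction.smul g x = y) :
    fiber x ≃ₗ[R] fiber y
  act_one {R : CommAlgCat.{u} k} (x : F.obj R)
    (h : PGLAction.smul (1 : GL (Fin n) R) x = x) (v : fiber x) : act 1 x x h v = v
  act_mul {R : CommAlgCat.{u} k} (g g' : GL (Fin n) R) (x y z : F.obj R)
    (h : PGLAction.smul g x = y) (h' : PGLAction.smul g' y = z)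
    (hh : PGLAction.smul (g' * g) x = z) (v : fiber x) :
    act (g' * g) x z hh v = act g' y z h' (act g x y h v)
  pull_act {R R' : CommAlgCat.{u} k} (f : R ⟶ R') (g : GL (Fin n) R) (x y : F.obj R)
    (x' y' : F.obj R') (h : PGLAction.smul g x = y) (hx : F.map f x = x') (hy : F.map f y = y')
    (h' : PGLAction.smul (Matrix.GeneralLinearGroup.map f.hom.toRingHom g) x' = y') (v : fiber x) :
    pull f y y' hy (act g x y h v) =
      act (Matrix.GeneralLinearGroup.map f.hom.toRingHom g) x' y' h' (pull f x x' hx v)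
  act_scalar {R : CommAlgCat.{u} k} (t : Rˣ) (x : F.obj R)
    (h : PGLAction.smul (Matrix.GeneralLinearGroup.scalar (Fin n) t) x = x) (v : fiber x) :
    act (Matrix.GeneralLinearGroup.scalar (Fin n) t) x x h v = (t ^ w) • v

/-! ### Grassmannian bundles -/

namespace VectorBundle

variable {F : CommAlgCat.{u} k ⥤ Type u} {r : ℕ}

/-- The `R`-points of the bundle `Gr_j(P)` of `j`-dimensional subspaces of `P`, where `j ≤ r`: an
`R`-point `x` of the base together with a submodule of the fibre over `x` whose quotient is
projective of rank `r - j`. -/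
structure GrPoint (P : VectorBundle F r) (j : ℕ) (R : CommAlgCat.{u} k) : Type u where
  base : F.obj R
  subspace : Module.Grassmannian R (P.fiber base) (r - j)

/-- Pull-back of points of `Gr_j(P)`. -/
def GrPoint.map (P : VectorBundle F r) {j : ℕ} {R R' : CommAlgCat.{u} k} (f : R ⟶ R')
    (a : P.GrPoint j R) : P.GrPoint j R' :=
  ⟨F.map f a.base, grassmannianMap (P.isBaseChange f a.base _ rfl) a.subspace⟩

theorem GrPoint.map_eq (P : VectorBundle F r) {j : ℕ} {R R' : CommAlgCat.{u} k} (f : R ⟶ R')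
    (a : P.GrPoint j R) (b : P.GrPoint j R') (h : F.map f a.base = b.base)
    (hm : Submodule.span R' (P.pull f a.base b.base h '' (a.subspace.toSubmodule : Set (P.fiber a.base)))
      = b.subspace.toSubmodule) :
    GrPoint.map P f a = b := by
  obtain ⟨y, M⟩ := b
  dsimp only at h
  subst h
  exact congrArg (GrPoint.mk _) (Module.Grassmannian.ext hm)

/-- The Grassmannian bundle `Gr_j(P)`, given by its functor of points. -/
def gr (P : VectorBundle F r) (j : ℕ) : CommAlgCat.{u} k ⥤ Type u where
  obj R := P.GrPoint j R
  map f := TypeCat.ofHom (GrPoint.map P f)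
  map_id R := by
    refine ConcreteCategory.hom_ext _ _ fun a => GrPoint.map_eq P _ a a (by simp) ?_
    rw [Set.image_congr fun v _ => P.pull_id a.base _ v, Set.image_id', Submodule.span_eq]
  map_comp {R R' R''} f g := by
    refine ConcreteCategory.hom_ext _ _ fun a =>
      GrPoint.map_eq P _ a (GrPoint.map P g (GrPoint.map P f a))
        (by simp [GrPoint.map]) ?_
    refine (congrArg
      (Submodule.span (M := P.fiber (GrPoint.map P g (GrPoint.map P f a)).base) R'')
      ((Set.image_congr fun v _ => P.pull_comp f g a.base _ _ rfl rfl _ v).trans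
        (Set.image_image _ _ _).symm)).trans (span_image_span _ _).symm

/-- The projection of `Gr_j(P)` to its base. -/
def grProj (P : VectorBundle F r) (j : ℕ) : P.gr j ⟶ F where
  app _ := TypeCat.ofHom fun a => a.base
  naturality _ _ _ := rfl

end VectorBundle

namespace WeightedBundle

variable {n : ℕ} {w : ℤ} {F : CommAlgCat.{u} k ⥤ Type u} [PGLAction n F] {r : ℕ}

/-- The action of `GL_n` on the points of `Gr_j(P)`. -/
def grSMul (P : WeightedBundle n w F r) {j : ℕ} {R : CommAlgCat.{u} k} (g : GL (Fin n) R)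
    (a : P.GrPoint j R) : P.GrPoint j R :=
  ⟨PGLAction.smul g a.base, grassmannianEquiv (P.act g a.base _ rfl) a.subspace⟩

theorem grSMul_eq (P : WeightedBundle n w F r) {j : ℕ} {R : CommAlgCat.{u} k} (g : GL (Fin n) R)
    (a b : P.GrPoint j R) (h : PGLAction.smul g a.base = b.base)
    (hm : P.act g a.base b.base h '' (a.subspace.toSubmodule : Set (P.fiber a.base)) = b.subspace.toSubmodule) :
    P.grSMul g a = b := by
  obtain ⟨y, M⟩ := b
  dsimp only at h
  subst h
  exact congrArg (VectorBundle.GrPoint.mk _) (Module.Grassmannian.ext (SetLike.coe_injective hm))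

end WeightedBundle

/-- The action of `PGL_n` on `Gr_j(P)` induced by the action of `GL_n` on a bundle `P` of weight
`w`. -/
instance grAction {n : ℕ} {w : ℤ} {F : CommAlgCat.{u} k ⥤ Type u} [PGLAction n F] {r : ℕ}
    (P : WeightedBundle n w F r) (j : ℕ) : PGLAction n (P.toVectorBundle.gr j) where
  smul g a := P.grSMul g a
  one_smul a := P.grSMul_eq 1 a a (PGLAction.one_smul a.base) <| by
    rw [Set.image_congr fun v _ => P.act_one a.base _ v, Set.image_id']
  mul_smul g h a := P.grSMul_eq (g * h) a (P.grSMul g (P.grSMul h a))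
    (PGLAction.mul_smul g h a.base) <| by
    exact (Set.image_congr fun v _ => P.act_mul h g a.base _ _ rfl rfl _ v).trans
      (Set.image_image _ _ _).symm
  map_smul {_ R'} f g a := by
    refine (P.grSMul_eq _ (VectorBundle.GrPoint.map P.toVectorBundle f a)
      (VectorBundle.GrPoint.map P.toVectorBundle f (P.grSMul g a))
      (PGLAction.map_smul f g a.base).symm ?_).symm
    have e := Submodule.map_span
      (P.act (Matrix.GeneralLinearGroup.map f.hom.toRingHom g) (F.map f a.base) _
        (PGLAction.map_smul f g a.base).symm).toLinearMap
      (P.pull f a.base _ rfl '' (a.subspace.toSubmodule : Set (P.fiber a.base)))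
    refine (congrArg SetLike.coe e).trans ?_
    refine congrArg (fun s => SetLike.coe (Submodule.span R' s)) ?_
    exact ((Set.image_image _ _ _).trans
      (Set.image_congr fun v _ => (P.pull_act f g a.base _ _ _ rfl rfl rfl _ v).symm)).trans
      (Set.image_image _ _ _).symm
  scalar_smul {R} t a := P.grSMul_eq _ a a (PGLAction.scalar_smul t a.base) <| by
    rw [Set.image_congr fun v _ => P.act_scalar t a.base _ v]
    ext v
    constructor
    · rintro ⟨v', hv', rfl⟩
      exact a.subspace.toSubmodule.smul_mem ((t ^ w : Rˣ) : R) hv'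
    · intro hv
      exact ⟨(t ^ w)⁻¹ • v, a.subspace.toSubmodule.smul_mem (((t ^ w)⁻¹ : Rˣ) : R) hv,
        smul_inv_smul (t ^ w) v⟩

/-! ### Birationally linear maps -/

/-- A field extension `σ : K → L` is purely transcendental if `L` is generated as a field over `K`
by a family of elements that are algebraically independent over `K`. -/
def IsPurelyTranscendental {K L : Type u} [Field K] [Field L] (σ : K →+* L) : Prop :=
  letI : Algebra K L := σ.toAlgebra
  ∃ (ι : Type u) (x : ι → L), AlgebraicIndependent K x ∧
    IntermediateField.adjoin K (Set.range x) = ⊤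

/-- A rational map `ρ : X ⤏ Y` of integral schemes is birationally linear if it is dominant and the
function field of `X` is purely transcendental over the function field of `Y`, through the
comorphism `σ` of `ρ`. -/
def IsBirationallyLinear {X Y : Scheme.{u}} [IsIntegral X] [IsIntegral Y] (ρ : X ⤏ Y) : Prop :=
  ρ.IsDominant ∧ ∃ σ : Y.functionField ⟶ X.functionField,
    Spec.map σ ≫ Y.fromSpecStalk (genericPoint Y) = ρ.fromFunctionField ∧
      IsPurelyTranscendental σ.hom

end PGLBundle

end

/-!
The idea is that over the generic point of `Y = X / PGL_n` the bundle `Q`, having the same weight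
as `P` and smaller rank, is a direct summand of `P`, in such a way that a generic `j`-dimensional
subspace `U` of `P` projects isomorphically to a subspace `V` of `Q`. Then `U` is the graph of a
homomorphism from `V` to the kernel of `P → Q`, and as the homomorphisms `V → ker` form a vector
space, `U` is described by `V` and by coefficients `t` with respect to a basis of that space. The
class of `V` and the `t` are coordinates on `Gr_j(P) / PGL_n`.

Let `K` be the function field of `Y`. The generic point of `Y` lifts to a point `x` of `X` over a
finite extension `L` of `K`. Bundles are handled through bases of their fibres at `x`: a
homomorphism of equivariant bundles over the generic orbit is a matrix over `L` which commutes with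
the matrices of the action of `GL_n` between any two pull-backs of `x` (`IsEquivariant`). Elements
of `GL_n` which move one pull-back to the same other one differ by scalars, and these act trivially
on `Hom(P, Q)` because the weights agree. So descent along `L / K` shows that equivariant matrices
generate all matrices (`exists_sum_smul_isEquivariant`). Since `K` is infinite, a generic
combination of them gives the splitting and the family of homomorphisms `V → ker` above
(`exists_slice`).

The map `(V, t) ↦ graph` descends to the quotients, and three facts are checked on points:
`V` and `t` determine the class of the graph (`graphImage_eq`), the class of the graph determines
the class of `V` (`framedImage_eq_of_graphImage_eq`), and it determines `t`
(`coeff_eq_of_graphImage_eq`). The generic point of `Gr_j(P) / PGL_n`, with function field `KP`, is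
the class of a graph over some extension `E` of `KP`. Comparing the two pull-backs to
`E ⊗[KP] E`, the coefficients `t` lie in `KP`, and the class of `V` is a `KP`-point of
`Gr_j(Q) / PGL_n` (`exists_generic_graph`). Comparing the two pull-backs to `E ⊗[N] E`, where `N`
is generated by the coordinates of this point and by `t`, gives `N = KP` (`adjoin_eq_top_of_graph`).

It remains to see that the `t` are algebraically independent over the local ring of
`Gr_j(Q) / PGL_n` at the image of this point, which makes the local ring a field, namely the
function field (`eq_zero_of_eval₂_eq_zero`). The class of `V` lifts to a frame over a local domain
`D` which dominates this local ring, and the graph over it with *indeterminate* coefficients is a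
point of `Gr_j(P) / PGL_n` over the polynomial ring `D[X]`. It specializes to the generic graph,
hence is generic itself, and by uniqueness of coefficients the `t` are identified with the
indeterminates.
-/

noncomputable section

namespace PGLBundle

variable {k : Type u} [Field k]

/-! ### Coordinates on the fibres of a vector bundle -/

/-- The basis of the base change `N` of `M` formed by the images of the elements of a basis
of `M`. -/
def IsSemilinearBaseChange.basis {R S M N : Type u} [CommRing R] [CommRing S] [AddCommGroup M]
    [AddCommGroup N] [Module R M] [Module S N] {σ : R →+* S} {β : M →ₛₗ[σ] N}
    (hβ : IsSemilinearBaseChange σ β) {ι : Type*} (b : Module.Basis ι R M) : Module.Basis ι S N :=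
  letI : Algebra R S := σ.toAlgebra
  letI : Module R N := Module.compHom N σ
  haveI : IsScalarTower R S N := ⟨fun r s v => mul_smul (σ r) s v⟩
  IsBaseChange.basis b hβ

theorem IsSemilinearBaseChange.basis_apply {R S M N : Type u} [CommRing R] [CommRing S]
    [AddCommGroup M] [AddCommGroup N] [Module R M] [Module S N] {σ : R →+* S} {β : M →ₛₗ[σ] N}
    (hβ : IsSemilinearBaseChange σ β) {ι : Type*} (b : Module.Basis ι R M) (i : ι) :
    hβ.basis b i = β (b i) := by
  let : Algebra R S := σ.toAlgebra
  let : Module R N := Module.compHom N σ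
  have : IsScalarTower R S N := ⟨fun r s v => mul_smul (σ r) s v⟩
  exact IsBaseChange.basis_apply b hβ i

variable {F : CommAlgCat.{u} k ⥤ Type u} {L T T' : CommAlgCat.{u} k} {x : F.obj L}

theorem map_comp_apply (F : CommAlgCat.{u} k ⥤ Type u) (f : L ⟶ T) (φ : T ⟶ T') (x : F.obj L) :
    F.map φ (F.map f x) = F.map (f ≫ φ) x := by simp

namespace VectorBundle

variable {r : ℕ}

/-- The basis of the fibre over the pull-back of `x` along `f` induced by a basis of the fibre
over `x`. -/
def basisAt (P : VectorBundle F r) (b : Module.Basis (Fin r) L (P.fiber x)) (f : L ⟶ T) :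
    Module.Basis (Fin r) T (P.fiber (F.map f x)) :=
  (P.isBaseChange f x _ rfl).basis b

theorem basisAt_apply (P : VectorBundle F r) (b : Module.Basis (Fin r) L (P.fiber x)) (f : L ⟶ T)
    (i : Fin r) : P.basisAt b f i = P.pull f x _ rfl (b i) :=
  (P.isBaseChange f x _ rfl).basis_apply b i

theorem pull_basisAt (P : VectorBundle F r) (b : Module.Basis (Fin r) L (P.fiber x)) (f : L ⟶ T)
    (φ : T ⟶ T') (i : Fin r) :
    P.pull φ (F.map f x) (F.map (f ≫ φ) x) (map_comp_apply F f φ x) (P.basisAt b f i) =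
      P.basisAt b (f ≫ φ) i := by
  rw [basisAt_apply, basisAt_apply, ← P.pull_comp f φ x _ _ rfl _ rfl]

end VectorBundle

namespace WeightedBundle

variable {n r : ℕ} {w : ℤ} [PGLAction n F]

/-- The matrix of the action of `g` between two pull-backs of the point `x`, in the bases pulled
back from `x`. -/
def transition (P : WeightedBundle n w F r) (b : Module.Basis (Fin r) L (P.fiber x)) {f₁ f₂ : L ⟶ T}
    (g : GL (Fin n) T) (h : PGLAction.smul g (F.map f₁ x) = F.map f₂ x) :
    Matrix (Fin r) (Fin r) T :=
  LinearMap.toMatrix (P.basisAt b f₁) (P.basisAt b f₂) (P.act g _ _ h).toLinearMap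

variable (P : WeightedBundle n w F r) (b : Module.Basis (Fin r) L (P.fiber x)) {f₁ f₂ f₃ : L ⟶ T}

theorem act_basisAt (g : GL (Fin n) T) (h : PGLAction.smul g (F.map f₁ x) = F.map f₂ x)
    (i : Fin r) : P.act g _ _ h (P.basisAt b f₁ i) =
      ∑ l, P.transition b g h l i • P.basisAt b f₂ l := by
  rw [transition]
  simp only [LinearMap.toMatrix_apply]
  exact ((P.basisAt b f₂).sum_repr _).symm

theorem transition_mul (g g' : GL (Fin n) T) (h : PGLAction.smul g (F.map f₁ x) = F.map f₂ x)
    (h' : PGLAction.smul g' (F.map f₂ x) = F.map f₃ x)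
    (hh : PGLAction.smul (g' * g) (F.map f₁ x) = F.map f₃ x) :
    P.transition b (g' * g) hh = P.transition b g' h' * P.transition b g h := by
  rw [transition, transition, transition, ← LinearMap.toMatrix_comp]
  congr 1
  exact LinearMap.ext fun v => P.act_mul g g' _ _ _ h h' hh v

theorem transition_map (φ : T ⟶ T') (g : GL (Fin n) T)
    (h : PGLAction.smul g (F.map f₁ x) = F.map f₂ x)
    (h' : PGLAction.smul (Matrix.GeneralLinearGroup.map φ.hom.toRingHom g) (F.map (f₁ ≫ φ) x) =
      F.map (f₂ ≫ φ) x) :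
    P.transition b _ h' = (P.transition b g h).map φ.hom := by
  ext l i
  rw [transition, LinearMap.toMatrix_apply, Matrix.map_apply]
  have e := P.pull_act φ g _ _ _ _ h (map_comp_apply F f₁ φ x) (map_comp_apply F f₂ φ x) h'
    (P.basisAt b f₁ i)
  rw [P.pull_basisAt, act_basisAt, map_sum] at e
  simp only [map_smulₛₗ, P.pull_basisAt] at e
  refine (congrArg (fun v => (P.basisAt b (f₂ ≫ φ)).repr v l) e.symm).trans ?_
  rw [Module.Basis.repr_sum_self]
  rfl

theorem _root_.PGLBundle.smul_map' {f₁' f₂' : L ⟶ T'} {g : GL (Fin n) T}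
    (h : PGLAction.smul g (F.map f₁ x) = F.map f₂ x) (φ : T ⟶ T') (h₁ : f₁ ≫ φ = f₁')
    (h₂ : f₂ ≫ φ = f₂') :
    PGLAction.smul (Matrix.GeneralLinearGroup.map φ.hom.toRingHom g) (F.map f₁' x) =
      F.map f₂' x := by
  subst h₁ h₂
  rw [← map_comp_apply, ← map_comp_apply, ← PGLAction.map_smul, h]

theorem transition_map' {f₁' f₂' : L ⟶ T'} {g : GL (Fin n) T}
    (h : PGLAction.smul g (F.map f₁ x) = F.map f₂ x) (φ : T ⟶ T') (h₁ : f₁ ≫ φ = f₁')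
    (h₂ : f₂ ≫ φ = f₂') :
    P.transition b _ (smul_map' h φ h₁ h₂) = (P.transition b g h).map φ.hom := by
  subst h₁ h₂
  exact P.transition_map b φ g h _

/-- The scalar matrix `t` changes the matrix of the action by `t ^ w`, where `w` is the weight. -/
theorem transition_scalar_mul (t : Tˣ) (g : GL (Fin n) T)
    (h : PGLAction.smul g (F.map f₁ x) = F.map f₂ x)
    (h' : PGLAction.smul (Matrix.GeneralLinearGroup.scalar (Fin n) t * g) (F.map f₁ x) =
      F.map f₂ x) :
    P.transition b _ h' = ((t ^ w : Tˣ) : T) • P.transition b g h := by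
  ext l i
  rw [transition, transition, LinearMap.toMatrix_apply, Matrix.smul_apply, LinearMap.toMatrix_apply]
  have h2 := PGLAction.scalar_smul (n := n) t (F.map f₂ x)
  have e := (P.act_mul g _ _ _ _ h h2 h' (P.basisAt b f₁ i)).trans (P.act_scalar t _ h2 _)
  refine (congrArg (fun v => (P.basisAt b f₂).repr v l) e).trans ?_
  rw [Units.smul_def, map_smul]
  rfl

theorem transition_one (h : PGLAction.smul (1 : GL (Fin n) T) (F.map f₁ x) = F.map f₁ x) :
    P.transition b 1 h = 1 := by
  rw [transition, ← LinearMap.toMatrix_id (P.basisAt b f₁)]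
  congr 1
  exact LinearMap.ext fun v => P.act_one _ h v

theorem _root_.PGLBundle.smul_inv {g : GL (Fin n) T} {y z : F.obj T} (h : PGLAction.smul g y = z) :
    PGLAction.smul g⁻¹ z = y := by
  rw [← h, ← PGLAction.mul_smul, inv_mul_cancel, PGLAction.one_smul]

theorem transition_inv_mul (g : GL (Fin n) T) (h : PGLAction.smul g (F.map f₁ x) = F.map f₂ x) :
    P.transition b g⁻¹ (smul_inv h) * P.transition b g h = 1 := by
  have h1 : PGLAction.smul (g⁻¹ * g) (F.map f₁ x) = F.map f₁ x := by
    rw [inv_mul_cancel, PGLAction.one_smul]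
  rw [← P.transition_mul b g g⁻¹ h (smul_inv h) h1]
  have : ∀ (g' : GL (Fin n) T) (e : g' = 1) (h' : PGLAction.smul g' (F.map f₁ x) = F.map f₁ x),
      P.transition b g' h' = 1 := by
    rintro _ rfl h'
    exact P.transition_one b h'
  exact this _ (inv_mul_cancel g) h1

theorem transition_mul_inv (g : GL (Fin n) T) (h : PGLAction.smul g (F.map f₁ x) = F.map f₂ x) :
    P.transition b g h * P.transition b g⁻¹ (smul_inv h) = 1 :=
  mul_eq_one_comm.1 (P.transition_inv_mul b g h)

end WeightedBundle

/-! ### Subspaces spanned by the columns of a matrix -/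

/-- A matrix is a frame if it has a left inverse: its columns then form a basis of a direct summand
of the free module of column vectors. -/
def IsFrame {R : Type*} [CommRing R] {r j : ℕ} (u : Matrix (Fin r) (Fin j) R) : Prop :=
  ∃ v : Matrix (Fin j) (Fin r) R, v * u = 1

theorem IsFrame.map {R S : Type*} [CommRing R] [CommRing S] {r j : ℕ}
    {u : Matrix (Fin r) (Fin j) R} (hu : IsFrame u) (f : R →+* S) : IsFrame (u.map f) := by
  obtain ⟨v, hv⟩ := hu
  exact ⟨v.map f, by rw [← Matrix.map_mul, hv, Matrix.map_one _ f.map_zero f.map_one]⟩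

theorem IsFrame.mul_left_cancel {R : Type*} [CommRing R] {r j : ℕ} {ι : Type*} [Fintype ι]
    {u : Matrix (Fin r) (Fin j) R} (hu : IsFrame u) {c d : Matrix (Fin j) ι R}
    (h : u * c = u * d) : c = d := by
  obtain ⟨v, hv⟩ := hu
  rw [← Matrix.one_mul c, ← hv, Matrix.mul_assoc, h, ← Matrix.mul_assoc, hv, Matrix.one_mul]

/-- The span of the vectors whose coordinates in the basis `B` are the columns of `u`. -/
def columnSpan {R N : Type*} [CommRing R] [AddCommGroup N] [Module R N] {r j : ℕ}
    (B : Module.Basis (Fin r) R N) (u : Matrix (Fin r) (Fin j) R) : Submodule R N :=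
  Submodule.span R (Set.range fun a => ∑ l, u l a • B l)

section columnSpan

variable {R N : Type*} [CommRing R] [AddCommGroup N] [Module R N] {r j : ℕ}
  (B : Module.Basis (Fin r) R N)

theorem sum_mul_smul_basis {i : ℕ} (u : Matrix (Fin r) (Fin j) R) (c : Matrix (Fin j) (Fin i) R)
    (a : Fin i) : ∑ l, (u * c) l a • B l = ∑ m, c m a • ∑ l, u l m • B l := by
  simp only [Matrix.mul_apply, Finset.sum_smul, Finset.smul_sum, smul_smul]
  rw [Finset.sum_comm]
  simp only [mul_comm]

theorem columnSpan_mul_le (u : Matrix (Fin r) (Fin j) R) (c : Matrix (Fin j) (Fin j) R) :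
    columnSpan B (u * c) ≤ columnSpan B u := by
  refine Submodule.span_le.2 ?_
  rintro _ ⟨a, rfl⟩
  dsimp only
  rw [sum_mul_smul_basis]
  exact Submodule.sum_mem _ fun m _ => Submodule.smul_mem _ _ (Submodule.subset_span ⟨m, rfl⟩)

theorem columnSpan_mul (u : Matrix (Fin r) (Fin j) R) {c : Matrix (Fin j) (Fin j) R}
    (hc : IsUnit c) : columnSpan B (u * c) = columnSpan B u := by
  obtain ⟨d, hd⟩ := hc.exists_right_inv
  refine le_antisymm (columnSpan_mul_le B u c) ?_
  have := columnSpan_mul_le B (u * c) d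
  rwa [Matrix.mul_assoc, hd, Matrix.mul_one] at this

theorem exists_eq_mul_of_columnSpan_le {u v : Matrix (Fin r) (Fin j) R}
    (h : columnSpan B u ≤ columnSpan B v) : ∃ c : Matrix (Fin j) (Fin j) R, u = v * c := by
  have h1 : ∀ a, ∃ d : Fin j → R, ∑ m, d m • ∑ l, v l m • B l = ∑ l, u l a • B l := fun a =>
    (Submodule.mem_span_range_iff_exists_fun R).1 (h (Submodule.subset_span ⟨a, rfl⟩))
  choose d hd using h1
  refine ⟨Matrix.of fun m a => d a m, ?_⟩
  ext l a
  have e : ∑ l, u l a • B l = ∑ l, (v * Matrix.of fun m a => d a m) l a • B l := by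
    rw [sum_mul_smul_basis, ← hd]
    rfl
  have e2 := congrArg (fun z => B.repr z l) e
  simpa only [Module.Basis.repr_sum_self] using e2

theorem exists_unit_of_columnSpan_eq {u v : Matrix (Fin r) (Fin j) R} (hv : IsFrame v)
    (h : columnSpan B u = columnSpan B v) :
    ∃ c : Matrix (Fin j) (Fin j) R, IsUnit c ∧ u = v * c := by
  obtain ⟨c, hc⟩ := exists_eq_mul_of_columnSpan_le B h.le
  obtain ⟨d, hd⟩ := exists_eq_mul_of_columnSpan_le B h.ge
  refine ⟨c, ?_, hc⟩
  have : c * d = 1 := by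
    apply hv.mul_left_cancel
    rw [← Matrix.mul_assoc, ← hc, ← hd, Matrix.mul_one]
  exact IsUnit.of_mul_eq_one d this

/-- A direct summand with a frame splits off from the ambient module. -/
theorem exists_equiv_prod_quotient_columnSpan {u : Matrix (Fin r) (Fin j) R} (hu : IsFrame u) :
    Nonempty (N ≃ₗ[R] (Fin j → R) × (N ⧸ columnSpan B u)) := by
  obtain ⟨v, hv⟩ := hu
  let U := Matrix.toLin (Pi.basisFun R (Fin j)) B u
  let V := Matrix.toLin B (Pi.basisFun R (Fin j)) v
  have hVU : ∀ c, V (U c) = c := fun c => by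
    have := Matrix.toLin_mul (Pi.basisFun R (Fin j)) B (Pi.basisFun R (Fin j)) v u
    rw [hv, Matrix.toLin_one] at this
    exact (LinearMap.congr_fun this c).symm
  have hr : columnSpan B u = LinearMap.range U := by
    rw [← Submodule.map_top, ← (Pi.basisFun R (Fin j)).span_eq, Submodule.map_span,
      ← Set.range_comp, columnSpan]
    congr 2
    ext1 a
    exact (Matrix.toLin_self _ _ _ _).symm
  refine ⟨LinearEquiv.ofBijective (V.prod (columnSpan B u).mkQ) ⟨?_, ?_⟩⟩
  · rw [← LinearMap.ker_eq_bot, LinearMap.ker_eq_bot']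
    intro z hz
    have h1 : V z = 0 := congrArg Prod.fst hz
    have h2 : (columnSpan B u).mkQ z = 0 := congrArg Prod.snd hz
    rw [Submodule.mkQ_apply, Submodule.Quotient.mk_eq_zero, hr] at h2
    obtain ⟨c, rfl⟩ := h2
    rw [hVU] at h1
    rw [h1, map_zero]
  · rintro ⟨c, z⟩
    obtain ⟨z, rfl⟩ := Submodule.mkQ_surjective _ z
    refine ⟨z + U (c - V z), Prod.ext ?_ ?_⟩
    · simp [hVU]
    · have : U (c - V z) ∈ columnSpan B u := hr ▸ LinearMap.mem_range_self U _
      rw [← Submodule.Quotient.mk_eq_zero] at this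
      exact (map_add _ _ _).trans ((congrArg _ this).trans (add_zero _))

/-- Over a local ring, a direct summand of a free module is spanned by a frame. -/
theorem exists_isFrame_of_isLocalRing [IsLocalRing R] (S : Submodule R N)
    [Module.Finite R (N ⧸ S)] [Module.Projective R (N ⧸ S)] (hj : j ≤ r)
    (hS : Module.finrank R (N ⧸ S) = r - j) :
    ∃ u : Matrix (Fin r) (Fin j) R, IsFrame u ∧ columnSpan B u = S := by
  have : Module.Finite R N := Module.Finite.of_basis B
  have : Module.Free R N := Module.Free.of_basis B
  obtain ⟨s, hs⟩ := Module.projective_lifting_property S.mkQ LinearMap.id S.mkQ_surjective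
  have hs' : ∀ y, S.mkQ (s y) = y := fun y => LinearMap.congr_fun hs y
  -- A section `s` of the quotient map gives a projection `π` to `S`, so that `S` is free too.
  let π : N →ₗ[R] S := (LinearMap.id - s ∘ₗ S.mkQ).codRestrict S fun z => by
    rw [← Submodule.Quotient.mk_eq_zero, ← Submodule.mkQ_apply, LinearMap.sub_apply, map_sub,
      LinearMap.comp_apply, hs', LinearMap.id_apply, sub_self]
  have hπ : π ∘ₗ S.subtype = LinearMap.id := LinearMap.ext fun z => Subtype.ext <| by
    have : S.mkQ z = 0 := (Submodule.Quotient.mk_eq_zero S).2 z.2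
    change (z : N) - s (S.mkQ z) = z
    rw [this, map_zero, sub_zero]
  have hfin : Module.Finite R S := Module.Finite.of_surjective π fun z =>
    ⟨z, LinearMap.congr_fun hπ z⟩
  have hproj : Module.Projective R S := Module.Projective.of_split S.subtype π hπ
  have : Module.Free R S := Module.free_of_flat_of_isLocalRing
  have : Module.Free R (N ⧸ S) := Module.free_of_flat_of_isLocalRing
  have hπs : ∀ y, π (s y) = 0 := fun y => Subtype.ext <| by
    change s y - s (S.mkQ (s y)) = 0
    rw [hs', sub_self]
  let e : N ≃ₗ[R] S × (N ⧸ S) := LinearEquiv.ofLinearMap (π.prod S.mkQ) (S.subtype.coprod s)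
    (LinearMap.ext fun ⟨z, y⟩ => Prod.ext
      ((map_add π _ _).trans (by
        refine (congrArg _ (hπs y)).trans ((add_zero _).trans ?_)
        exact LinearMap.congr_fun hπ z))
      ((map_add S.mkQ _ _).trans (by
        refine (congrArg _ (hs' y)).trans ?_
        refine (congrArg (· + y) ((Submodule.Quotient.mk_eq_zero S).2 z.2)).trans (zero_add y))))
    (LinearMap.ext fun z => sub_add_cancel z (s (S.mkQ z)))
  have hrank : Module.finrank R S = j := by
    have h1 := e.finrank_eq
    rw [Module.finrank_prod, hS, Module.finrank_eq_card_basis B, Fintype.card_fin] at h1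
    omega
  let C : Module.Basis (Fin j) R S := Module.finBasisOfFinrankEq R S hrank
  refine ⟨LinearMap.toMatrix C B S.subtype, ⟨LinearMap.toMatrix B C π, ?_⟩, ?_⟩
  · rw [← LinearMap.toMatrix_comp, hπ, LinearMap.toMatrix_id]
  · have : (fun a => ∑ l, (LinearMap.toMatrix C B S.subtype) l a • B l) =
        S.subtype ∘ C := by
      funext a
      simp only [LinearMap.toMatrix_apply]
      exact B.sum_repr _
    rw [columnSpan, this, Set.range_comp, ← Submodule.map_span, C.span_eq, Submodule.map_top,
      Submodule.range_subtype]

end columnSpan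

/-! ### Framed points of Grassmannian bundles -/

section Framed

variable {F : CommAlgCat.{u} k ⥤ Type u} {L T T' : CommAlgCat.{u} k} {x : F.obj L} {r j : ℕ}

/-- The point of `Gr_j(P)` over the pull-back of `x` along `f` whose subspace is spanned by the
columns of a frame `u`. -/
def VectorBundle.framedPoint (P : VectorBundle F r) (b : Module.Basis (Fin r) L (P.fiber x))
    (f : L ⟶ T) (u : Matrix (Fin r) (Fin j) T) (hu : IsFrame u) : P.GrPoint j T where
  base := F.map f x
  subspace :=
    { toSubmodule := columnSpan (P.basisAt b f) u
      finite_quotient := inferInstance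
      projective_quotient := by
        obtain ⟨e⟩ := exists_equiv_prod_quotient_columnSpan (P.basisAt b f) hu
        exact Module.Projective.of_split (e.symm.toLinearMap ∘ₗ LinearMap.inr _ _ _)
          (LinearMap.snd _ _ _ ∘ₗ e.toLinearMap) (by ext z; simp)
      rankAtStalk_eq p := by
        obtain ⟨e⟩ := exists_equiv_prod_quotient_columnSpan (P.basisAt b f) hu
        have : Nontrivial T := p.nontrivial
        have : Module.Projective T (P.fiber (F.map f x) ⧸ columnSpan (P.basisAt b f) u) :=
          Module.Projective.of_split (e.symm.toLinearMap ∘ₗ LinearMap.inr _ _ _)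
            (LinearMap.snd _ _ _ ∘ₗ e.toLinearMap) (by ext z; simp)
        have h := congrFun (Module.rankAtStalk_eq_of_equiv e) p
        rw [P.rank_eq, Module.rankAtStalk_prod, Pi.add_apply,
          Module.rankAtStalk_eq_finrank_of_free] at h
        simp at h
        omega }

theorem VectorBundle.span_pull_image_columnSpan (P : VectorBundle F r)
    (b : Module.Basis (Fin r) L (P.fiber x)) (f : L ⟶ T) (φ : T ⟶ T')
    (u : Matrix (Fin r) (Fin j) T) :
    Submodule.span T' (P.pull φ (F.map f x) (F.map (f ≫ φ) x) (map_comp_apply F f φ x) ''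
      (columnSpan (P.basisAt b f) u : Set (P.fiber (F.map f x)))) =
      columnSpan (P.basisAt b (f ≫ φ)) (u.map φ.hom) := by
  refine (span_image_span _ _).trans ?_
  rw [← Set.range_comp, columnSpan]
  congr 2
  funext a
  refine (map_sum _ _ _).trans (Finset.sum_congr rfl fun l _ => ?_)
  refine (map_smulₛₗ _ _ _).trans ?_
  rw [P.pull_basisAt b f φ l]
  rfl

theorem VectorBundle.map_framedPoint (P : VectorBundle F r)
    (b : Module.Basis (Fin r) L (P.fiber x)) (f : L ⟶ T) (φ : T ⟶ T')
    (u : Matrix (Fin r) (Fin j) T) (hu : IsFrame u) :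
    (P.gr j).map φ (P.framedPoint b f u hu) =
      P.framedPoint b (f ≫ φ) (u.map φ.hom) (hu.map φ.hom.toRingHom) :=
  VectorBundle.GrPoint.map_eq P φ _ _ (map_comp_apply F f φ x)
    (P.span_pull_image_columnSpan b f φ u)

variable {n : ℕ} {w : ℤ} [PGLAction n F] (P : WeightedBundle n w F r)
  (b : Module.Basis (Fin r) L (P.fiber x)) {f₁ f₂ : L ⟶ T}

theorem WeightedBundle.act_image_columnSpan {g : GL (Fin n) T}
    (h : PGLAction.smul g (F.map f₁ x) = F.map f₂ x) (u : Matrix (Fin r) (Fin j) T) :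
    P.act g _ _ h '' (columnSpan (P.basisAt b f₁) u : Set (P.fiber (F.map f₁ x))) =
      columnSpan (P.basisAt b f₂) (P.transition b g h * u) := by
  have e := Submodule.map_span (P.act g _ _ h).toLinearMap
    (Set.range fun a => ∑ l, u l a • P.basisAt b f₁ l)
  refine (congrArg SetLike.coe e).trans ?_
  rw [← Set.range_comp, columnSpan]
  congr 3
  funext a
  refine (map_sum _ _ _).trans ?_
  rw [sum_mul_smul_basis]
  refine Finset.sum_congr rfl fun l _ => ?_
  refine (map_smul _ _ _).trans (congrArg _ ?_)
  exact P.act_basisAt b g h l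

/-- An element of `GL_n` moves one framed point to another if it relates the frames up to a change
of basis of the subspace. -/
theorem WeightedBundle.smul_framedPoint {g : GL (Fin n) T}
    (h : PGLAction.smul g (F.map f₁ x) = F.map f₂ x) {u₁ u₂ : Matrix (Fin r) (Fin j) T}
    (hu₁ : IsFrame u₁) (hu₂ : IsFrame u₂) {c : Matrix (Fin j) (Fin j) T} (hc : IsUnit c)
    (hgu : P.transition b g h * u₁ = u₂ * c) :
    P.grSMul g (P.framedPoint b f₁ u₁ hu₁) = P.framedPoint b f₂ u₂ hu₂ := by
  refine P.grSMul_eq g _ _ h ?_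
  refine (P.act_image_columnSpan b h u₁).trans ?_
  rw [hgu, columnSpan_mul _ _ hc]
  rfl

theorem WeightedBundle.exists_of_grSMul_eq (P : WeightedBundle n w F r) {g : GL (Fin n) T}
    {a a' : P.GrPoint j T} (h : P.grSMul g a = a') :
    ∃ h : PGLAction.smul g a.base = a'.base,
      P.act g _ _ h '' (a.subspace.toSubmodule : Set (P.fiber a.base)) =
        a'.subspace.toSubmodule := by
  subst h
  exact ⟨rfl, rfl⟩

/-- Converse of `WeightedBundle.smul_framedPoint`. -/
theorem WeightedBundle.exists_of_smul_framedPoint {g : GL (Fin n) T}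
    {u₁ u₂ : Matrix (Fin r) (Fin j) T} (hu₁ : IsFrame u₁) (hu₂ : IsFrame u₂)
    (h : P.grSMul g (P.framedPoint b f₁ u₁ hu₁) = P.framedPoint b f₂ u₂ hu₂) :
    ∃ (h : PGLAction.smul g (F.map f₁ x) = F.map f₂ x) (c : Matrix (Fin j) (Fin j) T),
      IsUnit c ∧ P.transition b g h * u₁ = u₂ * c := by
  obtain ⟨h, hs⟩ := P.exists_of_grSMul_eq h
  refine ⟨h, exists_unit_of_columnSpan_eq (P.basisAt b f₂) hu₂ (SetLike.coe_injective ?_)⟩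
  exact (P.act_image_columnSpan b h u₁).symm.trans hs

/-- Over a local ring every point of `Gr_j(P)` over a pull-back of `x` has a frame. -/
theorem VectorBundle.exists_framedPoint_eq [IsLocalRing T] (P : VectorBundle F r)
    (b : Module.Basis (Fin r) L (P.fiber x)) (f : L ⟶ T) (hj : j ≤ r) (a : P.GrPoint j T)
    (h : a.base = F.map f x) : ∃ u hu, P.framedPoint b f u hu = a := by
  obtain ⟨y, V⟩ := a
  dsimp only at h
  subst h
  have := V.finite_quotient
  have := V.projective_quotient
  have : Module.Free T (P.fiber (F.map f x) ⧸ V.toSubmodule) := Module.free_of_flat_of_isLocalRing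
  obtain ⟨u, hu, e⟩ := exists_isFrame_of_isLocalRing (P.basisAt b f) V.toSubmodule hj (by
    have := V.rankAtStalk_eq (IsLocalRing.closedPoint T)
    rwa [Module.rankAtStalk_eq_finrank_of_free] at this)
  exact ⟨u, hu, congrArg (GrPoint.mk _) (Module.Grassmannian.ext e)⟩

end Framed

/-! ### Points of schemes and elements of `PGL_n` over local and Artinian rings -/

/-- The localization of a `k`-algebra at an element. -/
def away {T : CommAlgCat.{u} k} (a : T) : T ⟶ CommAlgCat.of k (Localization.Away a) :=
  CommAlgCat.ofHom (IsScalarTower.toAlgHom k T _)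

section Points

variable {Z : Scheme.{u}} [Z.Over (Spec (.of k))] {T T' : CommAlgCat.{u} k}

/-- Points of a scheme are determined Zariski-locally. -/
theorem points_ext_of_span {s : Set T} (hs : Ideal.span s = ⊤) {z z' : (points k Z).obj T}
    (h : ∀ a ∈ s, (points k Z).map (away a) z = (points k Z).map (away a) z') : z = z' := by
  refine Subtype.ext ?_
  let 𝒰 := (Scheme.affineOpenCoverOfSpanRangeEqTop (R := .of T) (fun a : s => (a : T))
    (by rwa [Subtype.range_coe])).openCover
  refine 𝒰.hom_ext _ _ fun a => ?_
  exact congrArg Subtype.val (h a.1 a.2)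

theorem eq_of_span {s : Set T} (hs : Ideal.span s = ⊤) {y z : T}
    (h : ∀ a ∈ s, (away a).hom y = (away a).hom z) : y = z :=
  Module.eq_of_isLocalized_span s hs (fun a => Localization.Away a.1)
    (fun a => Algebra.linearMap T (Localization.Away a.1)) y z fun a => h a a.2

/-- Points of a scheme with values in a finite product of rings are determined by their
components. -/
theorem points_ext_of_pi {ι : Type u} [Finite ι] {R : ι → CommAlgCat.{u} k} (φ : ∀ i, T ⟶ R i)
    (hφ : Function.Bijective fun (t : T) (i : ι) => (φ i).hom t) {z z' : (points k Z).obj T}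
    (h : ∀ i, (points k Z).map (φ i) z = (points k Z).map (φ i) z') : z = z' := by
  refine Subtype.ext ?_
  let e : T ≃+* ∀ i, R i := RingEquiv.ofBijective (RingHom.pi fun i => (φ i).hom.toRingHom) hφ
  let c : CommRingCat.of T ≅ CommRingCat.of (∀ i, R i) := e.toCommRingCatIso
  rw [← cancel_epi (Spec.map c.hom), ← cancel_epi (sigmaSpec fun i => .of (R i))]
  refine Limits.Sigma.hom_ext _ _ fun i => ?_
  rw [ι_sigmaSpec_assoc, ι_sigmaSpec_assoc, ← Spec.map_comp_assoc, ← Spec.map_comp_assoc]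
  exact congrArg Subtype.val (h i)

theorem eq_of_points_map_eq {K : CommAlgCat.{u} k} (z : (points k Z).obj K) [Mono z.1]
    {f₁ f₂ : K ⟶ T} (h : (points k Z).map f₁ z = (points k Z).map f₂ z) : f₁ = f₂ := by
  have h1 := (cancel_mono z.1).1 (congrArg Subtype.val h)
  ext t
  exact congrArg (fun g => g.hom t) (Spec.map_injective h1)

end Points

section Quotient

variable {n : ℕ} {F : CommAlgCat.{u} k ⥤ Type u} [PGLAction n F] {Z : Scheme.{u}}
    [Z.Over (Spec (.of k))] {q : F ⟶ points k Z} {T : CommAlgCat.{u} k}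

/-- Over a local ring, points with the same image in the quotient differ by an element of `GL_n`,
as one of the elements of a covering is invertible. -/
theorem IsPGLQuotient.exists_smul_eq_of_isLocalRing (hq : IsPGLQuotient n q) [IsLocalRing T]
    {x y : F.obj T} (h : q.app T x = q.app T y) : ∃ g : GL (Fin n) T, PGLAction.smul g x = y := by
  obtain ⟨s, hs, H⟩ := hq.transitive x y h
  obtain ⟨a, has, ha⟩ : ∃ a ∈ s, IsUnit a := by
    by_contra! hc
    refine (IsLocalRing.maximalIdeal.isMaximal T).ne_top (top_le_iff.1 ?_)
    rw [← hs, Ideal.span_le]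
    exact fun a ha => (IsLocalRing.mem_maximalIdeal a).2 (hc a ha)
  obtain ⟨g, hg⟩ := H a has
  have hu : ∀ y : Submonoid.powers a, IsUnit (AlgHom.id k T y) := by
    rintro ⟨_, m, rfl⟩
    exact ha.pow m
  let ψ : CommAlgCat.of k (Localization.Away a) ⟶ T :=
    CommAlgCat.ofHom (IsLocalization.liftAlgHom (M := Submonoid.powers a) hu)
  have hψ : away a ≫ ψ = 𝟙 T := by
    ext t
    exact IsLocalization.lift_eq _ t
  refine ⟨Matrix.GeneralLinearGroup.map ψ.hom.toRingHom g, ?_⟩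
  have hid : ∀ z : F.obj T, F.map ψ (F.map (away a) z) = z := fun z => by
    rw [map_comp_apply, hψ]
    simp
  have e := congrArg (F.map ψ) hg
  rw [PGLAction.map_smul] at e
  exact (congrArg _ (hid x)).symm.trans (e.trans (hid y))

/-- The analogue of `IsPGLQuotient.exists_smul_eq_of_isLocalRing` over an Artinian ring, which is
a finite product of local rings. The elements of `GL_n` over the factors are put together; that the
result relates `x` and `y` can be tested on the factors because the points are those of a scheme. -/
theorem IsPGLQuotient.exists_smul_eq_of_isArtinianRing {X : Scheme.{u}} [X.Over (Spec (.of k))]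
    [PGLAction n (points k X)] {q : points k X ⟶ points k Z} (hq : IsPGLQuotient n q)
    [IsArtinianRing T] {x y : (points k X).obj T} (h : q.app T x = q.app T y) :
    ∃ g : GL (Fin n) T, PGLAction.smul g x = y := by
  let e := MaximalSpectrum.toPiLocalizationEquiv T
  let φ : ∀ I : MaximalSpectrum T, T ⟶ CommAlgCat.of k (Localization.AtPrime I.asIdeal) :=
    fun I => CommAlgCat.ofHom (IsScalarTower.toAlgHom k T _)
  have hφ : ∀ t, (fun I => (φ I).hom t) = e t := fun t => rfl
  have H : ∀ I : MaximalSpectrum T, ∃ g : GL (Fin n) (Localization.AtPrime I.asIdeal),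
      PGLAction.smul (R := CommAlgCat.of k (Localization.AtPrime I.asIdeal)) g
        ((points k X).map (φ I) x) = (points k X).map (φ I) y := fun I => by
    have : IsLocalRing (CommAlgCat.of k (Localization.AtPrime I.asIdeal)) :=
      inferInstanceAs (IsLocalRing (Localization.AtPrime I.asIdeal))
    refine hq.exists_smul_eq_of_isLocalRing
      (T := CommAlgCat.of k (Localization.AtPrime I.asIdeal)) ?_
    rw [NatTrans.naturality_apply, NatTrans.naturality_apply, h]
  choose g hg using H
  let M : Matrix (Fin n) (Fin n) T := Matrix.of fun i l => e.symm fun I => g I i l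
  let M' : Matrix (Fin n) (Fin n) T := Matrix.of fun i l => e.symm fun I => (g I)⁻¹ i l
  have hM : ∀ I, M.map (φ I).hom = g I := fun I => by
    ext i l
    exact congrFun (e.apply_symm_apply _) I
  have hM' : ∀ I, M'.map (φ I).hom = ((g I)⁻¹ : GL (Fin n) _) := fun I => by
    ext i l
    exact congrFun (e.apply_symm_apply _) I
  have hinj : ∀ A : Matrix (Fin n) (Fin n) T, (∀ I, A.map (φ I).hom = 1) → A = 1 := by
    intro A hA
    ext i l
    refine e.injective (funext fun I => ?_)
    have := congrFun (congrFun (hA I) i) l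
    rw [← Matrix.map_one (φ I).hom (map_zero _) (map_one _)] at this
    exact this
  have h1 : M * M' = 1 := hinj _ fun I => by
    rw [Matrix.map_mul, hM, hM']
    exact (g I).mul_inv
  have h2 : M' * M = 1 := hinj _ fun I => by
    rw [Matrix.map_mul, hM, hM']
    exact (g I).inv_mul
  refine ⟨⟨M, M', h1, h2⟩, points_ext_of_pi φ e.bijective fun I => ?_⟩
  rw [PGLAction.map_smul, ← hg]
  congr 1
  exact Units.ext (hM I)

theorem IsPGLQuotient.exists_eq_scalar_mul (hq : IsPGLQuotient n q) {x y : F.obj T}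
    {g g' : GL (Fin n) T} (h : PGLAction.smul g x = y) (h' : PGLAction.smul g' x = y) :
    ∃ t : Tˣ, g' = Matrix.GeneralLinearGroup.scalar (Fin n) t * g := by
  obtain ⟨t, ht⟩ := hq.free (g' * g⁻¹) y (by
    rw [PGLAction.mul_smul, smul_inv h, h'])
  exact ⟨t, by rw [← ht, inv_mul_cancel_right]⟩

end Quotient

/-! ### Equivariant matrices -/

section Equivariant

variable {F : CommAlgCat.{u} k ⥤ Type u} {n p q r : ℕ} {w : ℤ} [PGLAction n F]
  {L : CommAlgCat.{u} k} {x : F.obj L}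
  {P : WeightedBundle n w F p} {b : Module.Basis (Fin p) L (P.fiber x)}
  {Q : WeightedBundle n w F q} {c : Module.Basis (Fin q) L (Q.fiber x)}
  {R : WeightedBundle n w F r} {d : Module.Basis (Fin r) L (R.fiber x)}

variable (b c) in
/-- A matrix `M` over `L` is equivariant if the linear map `P_x → Q_x` that it describes in the
bases `b` and `c` is compatible with the action of every element of `GL_n` which moves one pull-back
of `x` to another. Such a matrix describes a homomorphism of equivariant bundles on the orbit
of `x`. -/
def IsEquivariant (M : Matrix (Fin q) (Fin p) L) : Prop :=
  ∀ ⦃T : CommAlgCat.{u} k⦄ ⦃f₁ f₂ : L ⟶ T⦄ (g : GL (Fin n) T)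
    (h : PGLAction.smul g (F.map f₁ x) = F.map f₂ x),
    M.map f₂.hom * P.transition b g h = Q.transition c g h * M.map f₁.hom

theorem IsEquivariant.mul {M : Matrix (Fin r) (Fin q) L} {N : Matrix (Fin q) (Fin p) L}
    (hM : IsEquivariant c d M) (hN : IsEquivariant b c N) : IsEquivariant b d (M * N) :=
  fun T f₁ f₂ g h => by
    rw [Matrix.map_mul, Matrix.map_mul, Matrix.mul_assoc, hN g h, ← Matrix.mul_assoc, hM g h,
      Matrix.mul_assoc]

theorem IsEquivariant.sub {M N : Matrix (Fin q) (Fin p) L}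
    (hM : IsEquivariant b c M) (hN : IsEquivariant b c N) : IsEquivariant b c (M - N) :=
  fun T f₁ f₂ g h => by
    rw [Matrix.map_sub _ (map_sub _), Matrix.map_sub _ (map_sub _), Matrix.sub_mul, Matrix.mul_sub,
      hM g h, hN g h]

/-- Combinations of equivariant matrices with coefficients which have the same image under all
pull-backs are equivariant. -/
theorem IsEquivariant.sum_smul {ι : Type*} [Fintype ι] {a : ι → L}
    {M : ι → Matrix (Fin q) (Fin p) L} (hM : ∀ i, IsEquivariant b c (M i))
    (ha : ∀ ⦃T : CommAlgCat.{u} k⦄ ⦃f₁ f₂ : L ⟶ T⦄ (g : GL (Fin n) T),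
      PGLAction.smul g (F.map f₁ x) = F.map f₂ x → ∀ i, f₁.hom (a i) = f₂.hom (a i)) :
    IsEquivariant b c (∑ i, a i • M i) := fun T f₁ f₂ g h => by
  have e : ∀ f : L ⟶ T, (∑ i, a i • M i).map f.hom = ∑ i, f.hom (a i) • (M i).map f.hom := by
    intro f
    ext
    simp [Matrix.sum_apply]
  rw [e, e, Matrix.sum_mul, Matrix.mul_sum]
  refine Finset.sum_congr rfl fun i _ => ?_
  rw [Matrix.smul_mul, Matrix.mul_smul, hM i g h, ha g h i]

theorem IsEquivariant.inv {M N : Matrix (Fin p) (Fin p) L} (hM : IsEquivariant b b M)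
    (hMN : M * N = 1) : IsEquivariant b b N := fun T f₁ f₂ g h => by
  have h1 : ∀ f : L ⟶ T, N.map f.hom * M.map f.hom = 1 := fun f => by
    rw [← Matrix.map_mul, mul_eq_one_comm.1 hMN, Matrix.map_one _ (map_zero _) (map_one _)]
  have h2 : ∀ f : L ⟶ T, M.map f.hom * N.map f.hom = 1 := fun f => mul_eq_one_comm.1 (h1 f)
  calc N.map f₂.hom * P.transition b g h
      = N.map f₂.hom * (P.transition b g h * M.map f₁.hom) * N.map f₁.hom := by
        rw [Matrix.mul_assoc, Matrix.mul_assoc, h2, Matrix.mul_one]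
    _ = P.transition b g h * N.map f₁.hom := by
        rw [← hM g h, ← Matrix.mul_assoc, h1, Matrix.one_mul]

/-! ### Descent -/

variable {Z : Scheme.{u}} [Z.Over (Spec (.of k))] {γ : F ⟶ points k Z}
  {T : CommAlgCat.{u} k} {f₁ f₂ : L ⟶ T}

variable (b c) in
/-- Because `P` and `Q` have the same weight, two elements of `GL_n` which move one point to another
act on `Hom(P, Q)` in the same way. -/
theorem exists_transition_eq_smul (hγ : IsPGLQuotient n γ) {g g' : GL (Fin n) T}
    (h : PGLAction.smul g (F.map f₁ x) = F.map f₂ x)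
    (h' : PGLAction.smul g' (F.map f₁ x) = F.map f₂ x) :
    ∃ s : Tˣ, P.transition b g' h' = (s : T) • P.transition b g h ∧
      Q.transition c g' h' = (s : T) • Q.transition c g h := by
  obtain ⟨t, rfl⟩ := hγ.exists_eq_scalar_mul h h'
  exact ⟨t ^ w, P.transition_scalar_mul b t g h h', Q.transition_scalar_mul c t g h h'⟩

variable (b c) in
theorem exists_transition_eq_smul_one (hγ : IsPGLQuotient n γ) (e : f₁ = f₂) {g : GL (Fin n) T}
    (h : PGLAction.smul g (F.map f₁ x) = F.map f₂ x) :
    ∃ s : Tˣ, P.transition b g h = (s : T) • 1 ∧ Q.transition c g h = (s : T) • 1 := by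
  subst e
  have h1 : PGLAction.smul (1 : GL (Fin n) T) (F.map f₁ x) = F.map f₁ x := PGLAction.one_smul _
  obtain ⟨s, hs⟩ := exists_transition_eq_smul b c hγ h1 h
  exact ⟨s, by rw [hs.1, P.transition_one], by rw [hs.2, Q.transition_one]⟩

end Equivariant

section Descent

open TensorProduct

/-- Coefficients of a matrix over `T ⊗ L` with respect to a basis of `L`. -/
theorem matrix_eq_of_sum_eq {K L T ι m₁ m₂ : Type*} [Field K] [CommRing L] [Algebra K L]
    [Fintype ι] [CommRing T] [Algebra K T]
    (l : Module.Basis ι K L) {M N : ι → Matrix m₁ m₂ T}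
    (h : ∑ s, ((1 : T) ⊗ₜ[K] l s) • (M s).map (fun a => a ⊗ₜ[K] (1 : L)) =
      ∑ s, ((1 : T) ⊗ₜ[K] l s) • (N s).map (fun a => a ⊗ₜ[K] (1 : L))) (s : ι) : M s = N s := by
  ext i j
  have h1 := congrFun (congrFun h i) j
  simp only [Matrix.sum_apply, Matrix.smul_apply, Matrix.map_apply, smul_eq_mul,
    Algebra.TensorProduct.tmul_mul_tmul, one_mul, mul_one] at h1
  have h2 : ∀ N : ι → Matrix m₁ m₂ T, ∑ s, N s i j ⊗ₜ[K] l s =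
      ∑ s, N s i j • Algebra.TensorProduct.basis T l s := fun N =>
    Finset.sum_congr rfl fun s _ => by
      rw [Algebra.TensorProduct.basis_apply, TensorProduct.smul_tmul', smul_eq_mul, mul_one]
  rw [h2, h2] at h1
  have h3 := congrArg (fun z => (Algebra.TensorProduct.basis T l).repr z s) h1
  simpa only [Module.Basis.repr_sum_self] using h3

/-- The structure morphism of a `k`-algebra `L` over a `k`-algebra `K`. -/
def structureMap (K : Type u) [CommRing K] [Algebra k K] (L : CommAlgCat.{u} k) [Algebra K L]
    [IsScalarTower k K L] : CommAlgCat.of k K ⟶ L :=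
  CommAlgCat.ofHom (IsScalarTower.toAlgHom k K L)

variable {n p q : ℕ} {w : ℤ} {X Z : Scheme.{u}} [X.Over (Spec (.of k))] [Z.Over (Spec (.of k))]
  [PGLAction n (points k X)] {γ : points k X ⟶ points k Z}
  {K : Type u} [Field K] [Algebra k K] {L : CommAlgCat.{u} k} [Algebra K L] [IsScalarTower k K L]
  {x : (points k X).obj L} {y : (points k Z).obj (.of k K)}
  {P : WeightedBundle n w (points k X) p} (b : Module.Basis (Fin p) L (P.fiber x))
  {Q : WeightedBundle n w (points k X) q} (c : Module.Basis (Fin q) L (Q.fiber x))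

/-- If `x` lies over a monomorphism `Spec K ⟶ Z`, then pull-backs of `x` which belong to the same
orbit are pull-backs along homomorphisms which agree on `K`. -/
theorem map_algebraMap_eq_of_smul_eq [Mono y.1] (hγ : IsPGLQuotient n γ)
    (hx : γ.app _ x = (points k Z).map (structureMap K L) y)
    {T : CommAlgCat.{u} k} {f₁ f₂ : L ⟶ T} {g : GL (Fin n) T}
    (h : PGLAction.smul g ((points k X).map f₁ x) = (points k X).map f₂ x) (a : K) :
    f₁.hom (algebraMap K L a) = f₂.hom (algebraMap K L a) := by
  have e : structureMap K L ≫ f₁ = structureMap K L ≫ f₂ := by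
    refine eq_of_points_map_eq y ?_
    rw [← map_comp_apply, ← map_comp_apply, ← hx, ← NatTrans.naturality_apply,
      ← NatTrans.naturality_apply, ← h, hγ.invariant]
  exact congrArg (fun f => f.hom a) e

/-- Descent along a finite field extension `L / K`: every matrix is an `L`-linear combination of
equivariant matrices.

The two pull-backs of `x` to `L ⊗[K] L` are related by an element `g₀` of `GL_n`, and conjugation
by `g₀` gives a coaction on matrices. It is coassociative although `g₀` need not satisfy a cocycle
condition, as `g₀` is unique up to scalars. The components of the coaction of `H` with respect to a
basis of `L` over `K` are equivariant, and `H` is a combination of them. -/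
theorem exists_sum_smul_isEquivariant [Mono y.1] (hγ : IsPGLQuotient n γ)
    (hx : γ.app _ x = (points k Z).map (structureMap K L) y)
    [Module.Finite K L] {ι : Type*} [Fintype ι] (l : Module.Basis ι K L)
    (H : Matrix (Fin q) (Fin p) L) :
    ∃ N : ι → Matrix (Fin q) (Fin p) L,
      (∀ s, IsEquivariant b c (N s)) ∧ H = ∑ s, l s • N s := by
  let T₀ : CommAlgCat.{u} k := .of k (L ⊗[K] L)
  let i₁ : L ⟶ T₀ := CommAlgCat.ofHom
    ((Algebra.TensorProduct.includeRight : L →ₐ[K] L ⊗[K] L).restrictScalars k)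
  let i₂ : L ⟶ T₀ := CommAlgCat.ofHom Algebra.TensorProduct.includeLeft
  have : IsArtinianRing (L ⊗[K] L) := IsArtinianRing.of_finite K _
  have : IsArtinianRing T₀ := this
  obtain ⟨g₀, hg₀⟩ : ∃ g : GL (Fin n) T₀,
      PGLAction.smul g ((points k X).map i₁ x) = (points k X).map i₂ x := by
    have e : structureMap K L ≫ i₁ = structureMap K L ≫ i₂ := by
      ext a
      exact (Algebra.TensorProduct.tmul_one_eq_one_tmul a).symm
    refine hγ.exists_smul_eq_of_isArtinianRing ?_
    rw [NatTrans.naturality_apply, NatTrans.naturality_apply, hx, map_comp_apply, map_comp_apply, e]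
  -- `N s` are the coefficients of the conjugate `ρ` of `H` by `g₀`.
  let ρ : Matrix (Fin q) (Fin p) (L ⊗[K] L) :=
    Q.transition c g₀ hg₀ * H.map i₁.hom * P.transition b g₀⁻¹ (smul_inv hg₀)
  have hρ : ρ * P.transition b g₀ hg₀ = Q.transition c g₀ hg₀ * H.map i₁.hom := by
    rw [Matrix.mul_assoc, P.transition_inv_mul, Matrix.mul_one]
  let N : ι → Matrix (Fin q) (Fin p) L := fun s => Matrix.of fun i m =>
    (Algebra.TensorProduct.basis L l).repr (ρ i m) s
  have hN : ρ = ∑ s, ((1 : L) ⊗ₜ[K] l s) • (N s).map (fun a => a ⊗ₜ[K] (1 : L)) := by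
    ext i m
    conv_lhs => rw [← (Algebra.TensorProduct.basis L l).sum_repr (ρ i m)]
    simp only [Matrix.sum_apply, Matrix.smul_apply, Matrix.map_apply, smul_eq_mul,
      Algebra.TensorProduct.tmul_mul_tmul, one_mul, mul_one, Algebra.TensorProduct.basis_apply,
      TensorProduct.smul_tmul']
    rfl
  have hmap : ∀ {T : CommAlgCat.{u} k} (v : T₀ ⟶ T), ρ.map v.hom =
      ∑ s, (v.hom ((1 : L) ⊗ₜ[K] l s)) • (N s).map (i₂ ≫ v).hom := by
    intro T v
    rw [hN]
    ext i m
    simp only [Matrix.map_apply, Matrix.sum_apply, Matrix.smul_apply, smul_eq_mul]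
    refine (map_sum v.hom _ _).trans (Finset.sum_congr rfl fun s _ => ?_)
    exact map_mul v.hom _ _
  refine ⟨N, fun s T f₁ f₂ g h => ?_, ?_⟩
  -- Equivariance of `N s`: compare coefficients in `T ⊗[K] L`, where both pull-backs of `x` along
  -- `f₁` and `f₂` are compared with the same third one.
  · let : Algebra K T := (f₁.hom.toRingHom.comp (algebraMap K L)).toAlgebra
    have : IsScalarTower k K T := IsScalarTower.of_algebraMap_eq fun a => by
      change _ = f₁.hom (algebraMap K L (algebraMap k K a))
      rw [← IsScalarTower.algebraMap_apply k K L]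
      exact (f₁.hom.commutes a).symm
    let φ₁ : L →ₐ[K] T := { f₁.hom.toRingHom with commutes' := fun a => rfl }
    let φ₂ : L →ₐ[K] T :=
      { f₂.hom.toRingHom with
        commutes' := fun a => (map_algebraMap_eq_of_smul_eq hγ hx h a).symm }
    let T' : CommAlgCat.{u} k := .of k (T ⊗[K] L)
    let e : T ⟶ T' := CommAlgCat.ofHom Algebra.TensorProduct.includeLeft
    let v₁ : T₀ ⟶ T' := CommAlgCat.ofHom
      ((Algebra.TensorProduct.map φ₁ (AlgHom.id K L)).restrictScalars k)
    let v₂ : T₀ ⟶ T' := CommAlgCat.ofHom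
      ((Algebra.TensorProduct.map φ₂ (AlgHom.id K L)).restrictScalars k)
    have h₁ : i₂ ≫ v₁ = f₁ ≫ e := by
      ext a
      exact (Algebra.TensorProduct.map_tmul _ _ _ _).trans (by rw [map_one]; rfl)
    have h₂ : i₂ ≫ v₂ = f₂ ≫ e := by
      ext a
      exact (Algebra.TensorProduct.map_tmul _ _ _ _).trans (by rw [map_one]; rfl)
    have h₀ : i₁ ≫ v₁ = i₁ ≫ v₂ := by
      ext a
      exact (Algebra.TensorProduct.map_tmul _ _ _ _).trans
        (((Algebra.TensorProduct.map_tmul _ _ _ _).trans (by rw [map_one, map_one])).symm)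
    -- `G₁`, `G₂` and `G` connect three pull-backs of `x` to `T ⊗ L`.
    have hG₁ := smul_map' hg₀ v₁ rfl h₁
    have hG₂ := smul_map' hg₀ v₂ h₀.symm h₂
    have hG := smul_map' h e rfl rfl
    have hGG : PGLAction.smul (Matrix.GeneralLinearGroup.map e.hom.toRingHom g *
        Matrix.GeneralLinearGroup.map v₁.hom.toRingHom g₀) ((points k X).map (i₁ ≫ v₁) x) =
        (points k X).map (f₂ ≫ e) x := by rw [PGLAction.mul_smul, hG₁, hG]
    obtain ⟨s', hsP, hsQ⟩ := exists_transition_eq_smul b c hγ hGG hG₂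
    rw [P.transition_mul b _ _ hG₁ hG hGG] at hsP
    rw [Q.transition_mul c _ _ hG₁ hG hGG] at hsQ
    have e₁ : ρ.map v₁.hom * P.transition b _ hG₁ =
        Q.transition c _ hG₁ * H.map (i₁ ≫ v₁).hom := by
      rw [P.transition_map' b hg₀ v₁ rfl h₁, Q.transition_map' c hg₀ v₁ rfl h₁, ← Matrix.map_mul,
        hρ, Matrix.map_mul, Matrix.map_map]
      rfl
    have e₂ : ρ.map v₂.hom * P.transition b _ hG₂ =
        Q.transition c _ hG₂ * H.map (i₁ ≫ v₁).hom := by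
      rw [P.transition_map' b hg₀ v₂ h₀.symm h₂, Q.transition_map' c hg₀ v₂ h₀.symm h₂,
        ← Matrix.map_mul, hρ, Matrix.map_mul, Matrix.map_map, h₀]
      rfl
    have e₃ : ρ.map v₂.hom * P.transition b _ hG = Q.transition c _ hG * ρ.map v₁.hom := by
      rw [hsP, hsQ, Matrix.mul_smul, Matrix.smul_mul, Matrix.mul_assoc, ← e₁, ← Matrix.mul_assoc,
        ← Matrix.mul_assoc] at e₂
      have e₄ := congrArg (fun z => ((s'⁻¹ : T'ˣ) : T') • z) e₂
      simp only [smul_smul, Units.inv_mul, one_smul] at e₄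
      have e₅ := congrArg (· * P.transition b _ (smul_inv hG₁)) e₄
      simpa only [Matrix.mul_assoc, P.transition_mul_inv, Matrix.mul_one] using e₅
    rw [hmap, hmap, h₁, h₂, P.transition_map' b h e rfl rfl, Q.transition_map' c h e rfl rfl,
      Matrix.sum_mul, Matrix.mul_sum] at e₃
    refine matrix_eq_of_sum_eq l (M := fun s => (N s).map f₂.hom * P.transition b g h)
      (N := fun s => Q.transition c g h * (N s).map f₁.hom) ?_ s
    have hv : ∀ i, v₂.hom ((1 : L) ⊗ₜ[K] l i) = (1 : T) ⊗ₜ[K] l i := fun i =>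
      (Algebra.TensorProduct.map_tmul φ₂ (AlgHom.id K L) 1 (l i)).trans (by rw [map_one]; rfl)
    have hv' : ∀ i, v₁.hom ((1 : L) ⊗ₜ[K] l i) = (1 : T) ⊗ₜ[K] l i := fun i =>
      (Algebra.TensorProduct.map_tmul φ₁ (AlgHom.id K L) 1 (l i)).trans (by rw [map_one]; rfl)
    have he : ∀ {m₁ m₂ : ℕ} (A : Matrix (Fin m₁) (Fin m₂) T),
      A.map (fun a => a ⊗ₜ[K] (1 : L)) = A.map e.hom := fun A => rfl
    refine Eq.trans ?_ (e₃.trans ?_)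
    · refine Finset.sum_congr rfl fun i _ => ?_
      rw [he, Matrix.map_mul, Matrix.smul_mul, hv]
      rfl
    · refine Finset.sum_congr rfl fun i _ => ?_
      rw [he, Matrix.map_mul, Matrix.mul_smul, hv']
      rfl
  -- The multiplication map `L ⊗[K] L → L` sends `g₀` to a scalar, so that `ρ` specializes to `H`.
  · let μ : T₀ ⟶ L := CommAlgCat.ofHom
      ((Algebra.TensorProduct.lmul' K (S := L)).restrictScalars k)
    have h₁ : i₁ ≫ μ = 𝟙 L := by
      ext a
      exact (Algebra.TensorProduct.lmul'_apply_tmul _ _).trans (one_mul a)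
    have h₂ : i₂ ≫ μ = 𝟙 L := by
      ext a
      exact (Algebra.TensorProduct.lmul'_apply_tmul _ _).trans (mul_one a)
    obtain ⟨s, hsP, hsQ⟩ := exists_transition_eq_smul_one b c hγ rfl (smul_map' hg₀ μ h₁ h₂)
    rw [P.transition_map' b hg₀ μ h₁ h₂] at hsP
    rw [Q.transition_map' c hg₀ μ h₁ h₂] at hsQ
    have e := congrArg (fun M => M.map μ.hom) hρ
    simp only [Matrix.map_mul, hsP, hsQ, hmap, h₂, Matrix.mul_smul, Matrix.smul_mul, Matrix.mul_one,
      Matrix.one_mul, Matrix.map_map] at e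
    have e' := congrArg (fun z => ((s⁻¹ : Lˣ) : L) • z) e
    simp only [smul_smul, Units.inv_mul, one_smul] at e'
    have hi : ∀ a, μ.hom (i₁.hom a) = a := fun a => congrArg (fun f => f.hom a) h₁
    have hH : H.map (μ.hom ∘ i₁.hom) = H := by
      ext i m
      exact hi _
    rw [hH] at e'
    rw [← e']
    refine Finset.sum_congr rfl fun i _ => ?_
    exact congrArg (· • N i) (hi (l i))

end Descent

/-! ### Generic equivariant matrices -/

/-- A linear combination of square matrices over an extension of an infinite field `K`, if it is
invertible, can be replaced by an invertible one with coefficients in `K`. -/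
theorem exists_det_sum_smul_ne_zero {K E ι : Type*} [Field K] [Infinite K] [Field E] [Algebra K E]
    [Fintype ι] {q : ℕ} (M : ι → Matrix (Fin q) (Fin q) E) (c : ι → E)
    (h : (∑ i, c i • M i).det ≠ 0) : ∃ a : ι → K, (∑ i, algebraMap K E (a i) • M i).det ≠ 0 := by
  let D : MvPolynomial ι E :=
    (∑ i, (MvPolynomial.X i : MvPolynomial ι E) • (M i).map MvPolynomial.C).det
  have hD : ∀ a : ι → E, MvPolynomial.eval a D = (∑ i, a i • M i).det := fun a => by
    rw [RingHom.map_det]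
    congr 1
    ext l m
    simp [Matrix.sum_apply]
  by_contra! hc
  refine h ?_
  have h0 : D = 0 := MvPolynomial.funext_set (fun _ => Set.range (algebraMap K E))
    (fun _ => Set.infinite_range_of_injective (algebraMap K E).injective) fun a ha => by
      choose a' ha' using fun i => ha i trivial
      obtain rfl : (fun i => algebraMap K E (a' i)) = a := funext ha'
      rw [hD, hc, map_zero]
  rw [← hD, h0, map_zero]

theorem IsFrame.submatrix {R : Type*} [CommRing R] {p q j : ℕ} {v : Matrix (Fin p) (Fin q) R}
    (hv : IsFrame v) {e : Fin j → Fin q} (he : Function.Injective e) :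
    IsFrame (v.submatrix id e) := by
  obtain ⟨v', hv'⟩ := hv
  refine ⟨v'.submatrix e id, ?_⟩
  rw [← Matrix.submatrix_mul _ _ e id e Function.bijective_id, hv', Matrix.submatrix_one e he]

theorem isFrame_iff_linearIndependent_col {E : Type*} [Field E] {p q : ℕ}
    {v : Matrix (Fin p) (Fin q) E} : IsFrame v ↔ LinearIndependent E v.col := by
  rw [← Matrix.mulVec_injective_iff]
  constructor
  · rintro ⟨v', hv'⟩ a b hab
    have := congrArg (Matrix.mulVec v') hab
    simpa [Matrix.mulVec_mulVec, hv'] using this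
  · intro h
    obtain ⟨f, hf⟩ := LinearMap.exists_leftInverse_of_injective (Matrix.toLin' v)
      (LinearMap.ker_eq_bot.2 h)
    refine ⟨LinearMap.toMatrix' f, ?_⟩
    rw [← LinearMap.toMatrix'_toLin' v, ← LinearMap.toMatrix'_comp, hf, LinearMap.toMatrix'_id]

/-- Every frame can be completed by further columns. -/
theorem IsFrame.exists_extension {E : Type*} [Field E] {p q j : ℕ} (hj : j ≤ q) (hq : q ≤ p)
    {u : Matrix (Fin p) (Fin j) E} (hu : IsFrame u) :
    ∃ v : Matrix (Fin p) (Fin q) E, IsFrame v ∧ u = v.submatrix id (Fin.castLE hj) := by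
  induction q, hj using Nat.le_induction with
  | base => exact ⟨u, hu, rfl⟩
  | succ q hj ih =>
    obtain ⟨v, hv, rfl⟩ := ih (by omega)
    rw [isFrame_iff_linearIndependent_col] at hv
    obtain ⟨z, hz⟩ := exists_linearIndependent_snoc_of_lt_finrank hv (by simpa using hq)
    refine ⟨Matrix.of fun l => Fin.snoc (v l) (z l), isFrame_iff_linearIndependent_col.2 ?_, ?_⟩
    · have hcol : (Matrix.of fun l => Fin.snoc (v l) (z l) : Matrix (Fin p) (Fin (q + 1)) E).col =
          Fin.snoc v.col z := by
        funext a
        refine Fin.lastCases ?_ (fun a => ?_) a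
        · rw [Fin.snoc_last]
          exact funext fun l => Fin.snoc_last (α := fun _ => E) (z l) (v l)
        · rw [Fin.snoc_castSucc]
          exact funext fun l => Fin.snoc_castSucc (α := fun _ => E) (z l) (v l) a
      rw [hcol]
      exact hz
    · ext l a
      exact (Fin.snoc_castSucc (α := fun _ => E) (z l) (v l) (Fin.castLE hj a)).symm

/-- A presentation of `Q` as a direct summand of `P`: an equivariant matrix `incl : Q → P` with a
left inverse `proj : P → Q`, together with a family of equivariant matrices `shift i` from `Q` to
the kernel of `proj`. That `proj` is equivariant is not part of the structure. -/
structure Slice {F : CommAlgCat.{u} k ⥤ Type u} {n p q : ℕ} {w : ℤ} [PGLAction n F]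
    {L : CommAlgCat.{u} k} {x : F.obj L} {P : WeightedBundle n w F p}
    (b : Module.Basis (Fin p) L (P.fiber x)) {Q : WeightedBundle n w F q}
    (c : Module.Basis (Fin q) L (Q.fiber x)) (κ : Type) where
  proj : Matrix (Fin q) (Fin p) L
  incl : Matrix (Fin p) (Fin q) L
  shift : κ → Matrix (Fin p) (Fin q) L
  isEquivariant_incl : IsEquivariant c b incl
  isEquivariant_shift (i : κ) : IsEquivariant c b (shift i)
  proj_mul_incl : proj * incl = 1
  proj_mul_shift (i : κ) : proj * shift i = 0

namespace Slice

variable {F : CommAlgCat.{u} k ⥤ Type u} {n p q j : ℕ} {w : ℤ} [PGLAction n F]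
  {L T T' : CommAlgCat.{u} k} {x : F.obj L} {P : WeightedBundle n w F p}
  {b : Module.Basis (Fin p) L (P.fiber x)} {Q : WeightedBundle n w F q}
  {c : Module.Basis (Fin q) L (Q.fiber x)} {κ : Type} [Fintype κ] (S : Slice b c κ)

/-- The frame of the subspace of `P` which is the graph of the map `∑ t i • shift i` on the subspace
of `Q` with frame `v`. -/
def graph (f : L ⟶ T) (t : κ → T) (v : Matrix (Fin q) (Fin j) T) : Matrix (Fin p) (Fin j) T :=
  (S.incl.map f.hom + ∑ i, t i • (S.shift i).map f.hom) * v

theorem graph_mul (f : L ⟶ T) (t : κ → T) (v : Matrix (Fin q) (Fin j) T)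
    (d : Matrix (Fin j) (Fin j) T) : S.graph f t (v * d) = S.graph f t v * d :=
  (Matrix.mul_assoc _ _ _).symm

theorem proj_mul_graph (f : L ⟶ T) (t : κ → T) (v : Matrix (Fin q) (Fin j) T) :
    S.proj.map f.hom * S.graph f t v = v := by
  have h1 : S.proj.map f.hom * S.incl.map f.hom = 1 := by
    rw [← Matrix.map_mul, S.proj_mul_incl, Matrix.map_one _ (map_zero _) (map_one _)]
  have h2 : ∀ i, S.proj.map f.hom * (S.shift i).map f.hom = 0 := fun i => by
    rw [← Matrix.map_mul, S.proj_mul_shift, Matrix.map_zero _ (map_zero _)]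
  rw [graph, ← Matrix.mul_assoc, Matrix.mul_add, h1, Matrix.mul_sum]
  simp only [Matrix.mul_smul, h2, smul_zero, Finset.sum_const_zero, add_zero, Matrix.one_mul]

theorem isFrame_graph (f : L ⟶ T) (t : κ → T) {v : Matrix (Fin q) (Fin j) T} (hv : IsFrame v) :
    IsFrame (S.graph f t v) := by
  obtain ⟨v', hv'⟩ := hv
  exact ⟨v' * S.proj.map f.hom, by rw [Matrix.mul_assoc, S.proj_mul_graph, hv']⟩

theorem map_graph (f : L ⟶ T) (t : κ → T) (v : Matrix (Fin q) (Fin j) T) (φ : T ⟶ T') :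
    (S.graph f t v).map φ.hom = S.graph (f ≫ φ) (fun i => φ.hom (t i)) (v.map φ.hom) := by
  rw [graph, Matrix.map_mul, graph]
  congr 1
  ext l m
  simp only [Matrix.map_apply, Matrix.add_apply, Matrix.sum_apply, Matrix.smul_apply, smul_eq_mul,
    map_add, map_sum, map_mul]
  rfl

theorem transition_mul_graph {f₁ f₂ : L ⟶ T} (g : GL (Fin n) T)
    (h : PGLAction.smul g (F.map f₁ x) = F.map f₂ x) (t : κ → T) (v : Matrix (Fin q) (Fin j) T) :
    P.transition b g h * S.graph f₁ t v = S.graph f₂ t (Q.transition c g h * v) := by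
  rw [graph, graph, ← Matrix.mul_assoc, ← Matrix.mul_assoc, Matrix.mul_add, Matrix.add_mul _ _
    (Q.transition c g h), S.isEquivariant_incl g h, Matrix.mul_sum, Matrix.sum_mul]
  congr 2
  refine Finset.sum_congr rfl fun i _ => ?_
  rw [Matrix.mul_smul, Matrix.smul_mul, S.isEquivariant_shift i g h]

end Slice

section Slice

variable {n p q j : ℕ} {w : ℤ} {X Z : Scheme.{u}} [X.Over (Spec (.of k))] [Z.Over (Spec (.of k))]
  [PGLAction n (points k X)] {γ : points k X ⟶ points k Z}
  {K : Type u} [Field K] [Algebra k K] {L : CommAlgCat.{u} k} [Algebra K L] [IsScalarTower k K L]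
  {x : (points k X).obj L} {y : (points k Z).obj (.of k K)}
  {P : WeightedBundle n w (points k X) p} (b : Module.Basis (Fin p) L (P.fiber x))
  {Q : WeightedBundle n w (points k X) q} (c : Module.Basis (Fin q) L (Q.fiber x))

/-- A finite family of equivariant matrices which generates all matrices. -/
theorem exists_isEquivariant_family [Mono y.1] (hγ : IsPGLQuotient n γ)
    (hx : γ.app _ x = (points k Z).map (structureMap K L) y) [Module.Finite K L] :
    ∃ (ι : Type) (_ : Fintype ι) (N : ι → Matrix (Fin q) (Fin p) L),
      (∀ i, IsEquivariant b c (N i)) ∧ ∀ (E : Type u) [Field E] (ψ : L →+* E)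
        (H : Matrix (Fin q) (Fin p) E), ∃ a : ι → E, H = ∑ i, a i • (N i).map ψ := by
  let l := Module.finBasis K L
  choose N hN hs using fun il : Fin q × Fin p => exists_sum_smul_isEquivariant b c hγ hx l
    (Matrix.single il.1 il.2 1)
  refine ⟨(Fin q × Fin p) × Fin _, inferInstance, fun i => N i.1 i.2, fun i => hN i.1 i.2,
    fun E _ ψ H => ⟨fun i => H i.1.1 i.1.2 * ψ (l i.2), ?_⟩⟩
  rw [Fintype.sum_prod_type]
  have h1 : ∀ il : Fin q × Fin p, ∑ s, (H il.1 il.2 * ψ (l s)) • (N il s).map ψ =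
      Matrix.single il.1 il.2 (H il.1 il.2) := by
    intro il
    have h2 := congrArg (fun M => M.map ψ) (hs il)
    ext i m
    have h3 := congrFun (congrFun h2 i) m
    simp only [Matrix.map_apply, Matrix.sum_apply, Matrix.smul_apply, smul_eq_mul, map_sum,
      map_mul] at h3 ⊢
    simp only [mul_assoc, ← Finset.mul_sum, ← h3]
    by_cases hil : il.1 = i ∧ il.2 = m
    · simp [Matrix.single, hil]
    · simp [Matrix.single, hil]
  simp only [h1]
  rw [Fintype.sum_prod_type]
  exact Matrix.matrix_eq_sum_single H

/-- For every subspace of dimension `j` of a fibre of `P` over a field `E`, given by a frame `u`,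
there is a presentation of `Q` as a direct summand of `P` such that the projection to `Q` is
injective on the subspace, and such that the subspace is a graph over its projection, with unique
coefficients. -/
theorem exists_slice [Infinite K] [Mono y.1] (hγ : IsPGLQuotient n γ)
    (hx : γ.app _ x = (points k Z).map (structureMap K L) y) [Module.Finite K L]
    (hL : IsField L)
    (hj : j ≤ q) (hq : q ≤ p) {E : Type u} [Field E] (ψ : L →+* E) (u : Matrix (Fin p) (Fin j) E)
    (hu : IsFrame u) :
    ∃ (κ : Type) (_ : Fintype κ) (S : Slice b c κ) (v : Matrix (Fin q) (Fin j) E) (t : κ → E),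
      IsFrame v ∧ LinearIndependent E (fun i => (S.shift i).map ψ * v) ∧
      u = (S.incl.map ψ + ∑ i, t i • (S.shift i).map ψ) * v := by
  obtain ⟨ι, _, N, hN, hspan⟩ := exists_isEquivariant_family b c hγ hx
  obtain ⟨ι', _, N', hN', hspan'⟩ := exists_isEquivariant_family c b hγ hx
  let : Algebra K E := (ψ.comp (algebraMap K L)).toAlgebra
  have hcomb : ∀ {m₁ m₂ : ℕ} {o : Type} [Fintype o] (a : o → K)
      (M : o → Matrix (Fin m₁) (Fin m₂) L),
      (∑ i, algebraMap K L (a i) • M i).map ψ = ∑ i, algebraMap K E (a i) • (M i).map ψ := by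
    intro m₁ m₂ o _ a M
    ext
    simp only [Matrix.map_apply, Matrix.sum_apply, Matrix.smul_apply, smul_eq_mul, map_sum, map_mul]
    rfl
  obtain ⟨W, ⟨W', hW⟩, huW⟩ := hu.exists_extension hj hq
  -- Choose `α` such that `α * W` is invertible.
  obtain ⟨a, ha⟩ := hspan E ψ W'
  obtain ⟨a₁, ha₁⟩ := exists_det_sum_smul_ne_zero (K := K) (fun i => (N i).map ψ * W) a (by
    simp only [← Matrix.smul_mul]
    rw [← Matrix.sum_mul, ← ha, hW, Matrix.det_one]
    exact one_ne_zero)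
  simp only [← Matrix.smul_mul] at ha₁
  rw [← Matrix.sum_mul, ← hcomb] at ha₁
  set α : Matrix (Fin q) (Fin p) L := ∑ i, algebraMap K L (a₁ i) • N i with hα
  have hαe : IsEquivariant b c α := IsEquivariant.sum_smul hN fun T f₁ f₂ g hg i =>
    map_algebraMap_eq_of_smul_eq hγ hx hg _
  -- Choose `β₀` such that `α * β₀` is invertible.
  obtain ⟨a', ha'⟩ := hspan' E ψ W
  obtain ⟨a₂, ha₂⟩ := exists_det_sum_smul_ne_zero (K := K) (fun i => α.map ψ * (N' i).map ψ) a' (by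
    simp only [← Matrix.mul_smul]
    rwa [← Matrix.mul_sum, ← ha'])
  simp only [← Matrix.mul_smul] at ha₂
  rw [← Matrix.mul_sum, ← hcomb, ← Matrix.map_mul] at ha₂
  set β₀ : Matrix (Fin p) (Fin q) L := ∑ i, algebraMap K L (a₂ i) • N' i with hβ₀
  have hβ₀e : IsEquivariant c b β₀ := IsEquivariant.sum_smul hN' fun T f₁ f₂ g hg i =>
    map_algebraMap_eq_of_smul_eq hγ hx hg _
  have hdet : IsUnit (α * β₀).det := by
    obtain ⟨d, hd⟩ := hL.mul_inv_cancel (a := (α * β₀).det) fun h0 => ha₂ (by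
      have := RingHom.map_det ψ (α * β₀)
      rw [h0, map_zero] at this
      exact this.symm)
    exact IsUnit.of_mul_eq_one d hd
  set β : Matrix (Fin p) (Fin q) L := β₀ * (α * β₀)⁻¹ with hβ
  have hαβ : α * β = 1 := by
    rw [hβ, ← Matrix.mul_assoc, Matrix.mul_nonsing_inv _ hdet]
  have hβe : IsEquivariant c b β :=
    hβ₀e.mul ((hαe.mul hβ₀e).inv (Matrix.mul_nonsing_inv _ hdet))
  have hαβ' : α.map ψ * β.map ψ = 1 := by
    rw [← Matrix.map_mul, hαβ, Matrix.map_one _ (map_zero _) (map_one _)]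
  clear_value β
  set v : Matrix (Fin q) (Fin j) E := α.map ψ * u with hv
  have hvf : IsFrame v := by
    have hu' : IsFrame (α.map ψ * W) :=
      ⟨_, Matrix.nonsing_inv_mul _ (isUnit_iff_ne_zero.2 ha₁)⟩
    rw [hv, huW]
    have h1 := hu'.submatrix (Fin.castLE_injective hj)
    rwa [Matrix.submatrix_mul _ _ id id _ Function.bijective_id, Matrix.submatrix_id_id] at h1
  -- The matrices `N' i - β * α * N' i` generate the homomorphisms to the kernel of `α`.
  let h₀ : ι' → Matrix (Fin p) (Fin q) L := fun i => N' i - β * (α * N' i)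
  have hh₀ : ∀ i, α * h₀ i = 0 := fun i => by
    rw [Matrix.mul_sub, ← Matrix.mul_assoc, hαβ, Matrix.one_mul, sub_self]
  have hh₀e : ∀ i, IsEquivariant c b (h₀ i) := fun i =>
    (hN' i).sub (hβe.mul (hαe.mul (hN' i)))
  obtain ⟨κ, e, he, hspan₀, hli⟩ := exists_linearIndependent' E fun i => (h₀ i).map ψ * v
  have : Finite κ := Finite.of_injective e he
  have : Fintype κ := Fintype.ofFinite κ
  obtain ⟨t, ht⟩ : ∃ t : κ → E, ∑ i, t i • ((h₀ (e i)).map ψ * v) = u - β.map ψ * v := by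
    refine (Submodule.mem_span_range_iff_exists_fun E).1 ?_
    have hr : Submodule.span E (Set.range fun i => (h₀ (e i)).map ψ * v) =
      Submodule.span E (Set.range fun i => (h₀ i).map ψ * v) := hspan₀
    rw [hr]
    obtain ⟨v', hv'⟩ := hvf
    obtain ⟨a, ha⟩ := hspan' E ψ ((u - β.map ψ * v) * v')
    refine (Submodule.mem_span_range_iff_exists_fun E).2 ⟨a, ?_⟩
    have h1 : u - β.map ψ * v = ∑ i, a i • ((N' i).map ψ * v) := by
      simp only [← Matrix.smul_mul]
      rw [← Matrix.sum_mul, ← ha, Matrix.mul_assoc, hv', Matrix.mul_one]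
    have h2 : α.map ψ * (u - β.map ψ * v) = 0 := by
      rw [Matrix.mul_sub, ← Matrix.mul_assoc, hαβ', Matrix.one_mul, ← hv, sub_self]
    have h3 : ∑ i, a i • ((h₀ i).map ψ * v) = (∑ i, a i • ((N' i).map ψ * v)) -
        β.map ψ * (α.map ψ * ∑ i, a i • ((N' i).map ψ * v)) := by
      rw [Matrix.mul_sum, Matrix.mul_sum, ← Finset.sum_sub_distrib]
      refine Finset.sum_congr rfl fun i _ => ?_
      rw [Matrix.map_sub _ (map_sub _), Matrix.map_mul, Matrix.map_mul, Matrix.sub_mul, smul_sub]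
      simp only [Matrix.mul_smul, Matrix.mul_assoc]
    rw [h3, ← h1, h2, Matrix.mul_zero, sub_zero]
  refine ⟨κ, inferInstance, ⟨α, β, fun i => h₀ (e i), hβe, fun i => hh₀e _, hαβ,
    fun i => hh₀ _⟩, v, t, hvf, hli, ?_⟩
  rw [Matrix.add_mul, Matrix.sum_mul]
  simp only [Matrix.smul_mul]
  rw [ht, add_sub_cancel]

end Slice

/-! ### Framed points of the quotients of Grassmannian bundles -/

/-- Linear independence over a field is preserved by extension of scalars. -/
theorem eq_zero_of_sum_smul_map_eq_zero {E T κ m₁ m₂ : Type*} [Field E] [CommRing T] [Fintype κ]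
    (φ : E →+* T) {M : κ → Matrix m₁ m₂ E} (hM : LinearIndependent E M) {a : κ → T}
    (h : ∑ i, a i • (M i).map φ = 0) (i : κ) : a i = 0 := by
  let : Algebra E T := φ.toAlgebra
  rw [← Module.forall_dual_apply_eq_zero_iff E]
  intro f
  refine Fintype.linearIndependent_iff.1 hM (fun i => f (a i)) ?_ i
  ext l m
  have h1 := congrArg f (congrFun (congrFun h l) m)
  simp only [Matrix.sum_apply, Matrix.smul_apply, Matrix.map_apply, smul_eq_mul, Matrix.zero_apply,
    map_sum, map_zero] at h1 ⊢
  rw [← h1]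
  refine Finset.sum_congr rfl fun i _ => ?_
  have : a i * φ (M i l m) = (M i l m) • a i := by rw [mul_comm, Algebra.smul_def]; rfl
  rw [this, map_smul, smul_eq_mul, mul_comm]

section Framed

variable {F : CommAlgCat.{u} k ⥤ Type u} {n p q j : ℕ} {w : ℤ} [PGLAction n F]
  {L T T' : CommAlgCat.{u} k} {x : F.obj L} {P : WeightedBundle n w F p}
  (b : Module.Basis (Fin p) L (P.fiber x)) {Q : WeightedBundle n w F q}
  {c : Module.Basis (Fin q) L (Q.fiber x)}
  {ZP : Scheme.{u}} [ZP.Over (Spec (.of k))] {πP : P.gr j ⟶ points k ZP}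
  {ZQ : Scheme.{u}} [ZQ.Over (Spec (.of k))] {πQ : Q.gr j ⟶ points k ZQ}
  {f₁ f₂ : L ⟶ T}

variable (πP) in
/-- The image in `Gr_j(P) / PGL_n` of the point of `Gr_j(P)` with frame `u` over the pull-back of
`x` along `f`. -/
def framedImage (f : L ⟶ T) (u : Matrix (Fin p) (Fin j) T) (hu : IsFrame u) :
    (points k ZP).obj T :=
  πP.app T (P.framedPoint b f u hu)

theorem map_framedImage (f : L ⟶ T) (u : Matrix (Fin p) (Fin j) T) (hu : IsFrame u)
    (φ : T ⟶ T') : (points k ZP).map φ (framedImage b πP f u hu) =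
      framedImage b πP (f ≫ φ) (u.map φ.hom) (hu.map φ.hom.toRingHom) :=
  (NatTrans.naturality_apply πP φ (P.framedPoint b f u hu)).symm.trans
    (congrArg (πP.app T') (P.map_framedPoint b f φ u hu))

/-- Two frames have the same image in the quotient if and only if, locally, they differ by the
action of `GL_n` and a change of basis. -/
theorem framedImage_eq_iff (hπ : IsPGLQuotient n πP) {u₁ u₂ : Matrix (Fin p) (Fin j) T}
    (hu₁ : IsFrame u₁) (hu₂ : IsFrame u₂) :
    framedImage b πP f₁ u₁ hu₁ = framedImage b πP f₂ u₂ hu₂ ↔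
      ∃ s : Set T, Ideal.span s = ⊤ ∧ ∀ a ∈ s,
        ∃ (g : GL (Fin n) (CommAlgCat.of k (Localization.Away a)))
          (h : PGLAction.smul g (F.map (f₁ ≫ away a) x) = F.map (f₂ ≫ away a) x)
          (d : Matrix (Fin j) (Fin j) (Localization.Away a)), IsUnit d ∧
          P.transition b g h * u₁.map (away a).hom = u₂.map (away a).hom * d := by
  constructor
  · intro h
    obtain ⟨s, hs, H⟩ := hπ.transitive _ _ h
    refine ⟨s, hs, fun a ha => ?_⟩
    obtain ⟨g, hg⟩ := H a ha
    have e₁ := P.map_framedPoint b f₁ (away a) u₁ hu₁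
    have e₂ := P.map_framedPoint b f₂ (away a) u₂ hu₂
    refine ⟨g, P.exists_of_smul_framedPoint b (hu₁.map (away a).hom.toRingHom)
      (hu₂.map (away a).hom.toRingHom) ?_⟩
    rw [← e₁, ← e₂]
    exact hg
  · rintro ⟨s, hs, H⟩
    refine points_ext_of_span hs fun a ha => ?_
    obtain ⟨g, h, d, hd, e⟩ := H a ha
    rw [map_framedImage, map_framedImage]
    have e' := P.smul_framedPoint b h (hu₁.map (away a).hom.toRingHom)
      (hu₂.map (away a).hom.toRingHom) hd e
    exact ((hπ.invariant g _).symm).trans (congrArg (πP.app _) e')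

variable {b} {κ : Type} [Fintype κ] (S : Slice b c κ) {v₁ v₂ : Matrix (Fin q) (Fin j) T}

variable (πP) in
/-- The image in `Gr_j(P) / PGL_n` of the graph of `∑ t i • shift i` on the subspace of `Q` with
frame `v`, over the pull-back of `x` along `f`. -/
def graphImage (f : L ⟶ T) (t : κ → T) (v : Matrix (Fin q) (Fin j) T) (hv : IsFrame v) :
    (points k ZP).obj T :=
  framedImage b πP f (S.graph f t v) (S.isFrame_graph f t hv)

theorem map_graphImage (f : L ⟶ T) (t : κ → T) (v : Matrix (Fin q) (Fin j) T) (hv : IsFrame v)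
    (φ : T ⟶ T') : (points k ZP).map φ (graphImage πP S f t v hv) =
      graphImage πP S (f ≫ φ) (fun i => φ.hom (t i)) (v.map φ.hom) (hv.map φ.hom.toRingHom) := by
  rw [graphImage, graphImage, map_framedImage]
  congr 1
  exact S.map_graph f t v φ

/-- The class of a graph is determined by the class of the subspace of `Q` and the coefficients. -/
theorem graphImage_eq (hπP : IsPGLQuotient n πP) (hπQ : IsPGLQuotient n πQ) (t : κ → T)
    (hv₁ : IsFrame v₁) (hv₂ : IsFrame v₂)
    (h : framedImage c πQ f₁ v₁ hv₁ = framedImage c πQ f₂ v₂ hv₂) :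
    graphImage πP S f₁ t v₁ hv₁ = graphImage πP S f₂ t v₂ hv₂ := by
  obtain ⟨s, hs, H⟩ := (framedImage_eq_iff c hπQ hv₁ hv₂).1 h
  refine (framedImage_eq_iff b hπP _ _).2 ⟨s, hs, fun a ha => ?_⟩
  obtain ⟨g, h, d, hd, e⟩ := H a ha
  refine ⟨g, h, d, hd, ?_⟩
  rw [S.map_graph, S.map_graph, S.transition_mul_graph, e, S.graph_mul]

/-- The class of a graph determines the class of the subspace of `Q`. -/
theorem framedImage_eq_of_graphImage_eq (hπP : IsPGLQuotient n πP) (hπQ : IsPGLQuotient n πQ)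
    {t₁ t₂ : κ → T} (hv₁ : IsFrame v₁) (hv₂ : IsFrame v₂)
    (h : graphImage πP S f₁ t₁ v₁ hv₁ = graphImage πP S f₂ t₂ v₂ hv₂) :
    framedImage c πQ f₁ v₁ hv₁ = framedImage c πQ f₂ v₂ hv₂ := by
  obtain ⟨s, hs, H⟩ := (framedImage_eq_iff b hπP _ _).1 h
  refine (framedImage_eq_iff c hπQ hv₁ hv₂).2 ⟨s, hs, fun a ha => ?_⟩
  obtain ⟨g, h, d, hd, e⟩ := H a ha
  refine ⟨g, h, d, hd, ?_⟩
  rw [S.map_graph, S.map_graph, S.transition_mul_graph] at e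
  have e' := congrArg (S.proj.map (f₂ ≫ away a).hom * ·) e
  simpa only [← Matrix.mul_assoc, S.proj_mul_graph] using e'

/-- If the shifts are independent on the subspace of `Q` with frame `v`, then the coefficients
of a graph over this subspace are unique. -/
theorem coeff_eq_of_graphImage_eq {E : Type u} [Field E] [Algebra k E] {f : L ⟶ .of k E}
    {v : Matrix (Fin q) (Fin j) E} (hv : IsFrame v)
    (hli : LinearIndependent E (fun i => (S.shift i).map f.hom * v)) (hπP : IsPGLQuotient n πP)
    (φ : CommAlgCat.of k E ⟶ T) {t₁ t₂ : κ → T} (hv₁ : IsFrame v₁)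
    (h : graphImage πP S f₁ t₁ v₁ hv₁ =
      graphImage πP S (f ≫ φ) t₂ (v.map φ.hom) (hv.map φ.hom.toRingHom)) :
    t₁ = t₂ := by
  obtain ⟨s, hs, H⟩ := (framedImage_eq_iff b hπP _ _).1 h
  funext i
  refine eq_of_span hs fun a ha => ?_
  obtain ⟨g, h, d, hd, e⟩ := H a ha
  rw [S.map_graph, S.map_graph, S.transition_mul_graph] at e
  have e₁ := congrArg (S.proj.map ((f ≫ φ) ≫ away a).hom * ·) e
  simp only [← Matrix.mul_assoc, S.proj_mul_graph] at e₁
  rw [e₁, S.graph_mul] at e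
  obtain ⟨d', hd'⟩ := hd.exists_right_inv
  have e₂ := congrArg (· * d') e
  simp only [Matrix.mul_assoc, hd', Matrix.mul_one] at e₂
  rw [Slice.graph, Slice.graph, Matrix.add_mul, Matrix.add_mul, add_right_inj, Matrix.sum_mul,
    Matrix.sum_mul, ← sub_eq_zero, ← Finset.sum_sub_distrib] at e₂
  have e₃ := eq_zero_of_sum_smul_map_eq_zero ((φ ≫ away a).hom.toRingHom) hli
    (a := fun i => (away a).hom (t₁ i) - (away a).hom (t₂ i)) (by
      refine Eq.trans (Finset.sum_congr rfl fun i _ => ?_) e₂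
      rw [sub_smul, Matrix.smul_mul, Matrix.smul_mul, Matrix.map_mul]
      rfl) i
  exact sub_eq_zero.1 e₃

end Framed

/-! ### Lifting points of the quotient to frames -/

/-- A faithfully flat algebra over a local domain dominates it by a local domain: localize at a
prime over the maximal ideal and divide by a minimal prime, which lies over `0` by flatness. -/
theorem exists_local_domain_of_faithfullyFlat {R S : Type u} [CommRing R] [IsDomain R]
    [IsLocalRing R] [CommRing S] [Algebra R S] [Module.FaithfullyFlat R S] :
    ∃ (D : Type u) (_ : CommRing D) (_ : IsDomain D) (_ : IsLocalRing D) (χ : S →+* D),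
      Function.Injective (χ.comp (algebraMap R S)) ∧ IsLocalHom (χ.comp (algebraMap R S)) := by
  obtain ⟨q, hq⟩ := PrimeSpectrum.comap_surjective_of_faithfullyFlat (A := R) (B := S)
    (IsLocalRing.closedPoint R)
  let S' := Localization.AtPrime q.asIdeal
  have : Module.Flat S S' := IsLocalization.flat S' q.asIdeal.primeCompl
  have hflat : Module.Flat R S' := Module.Flat.trans R S S'
  obtain ⟨𝔭, h𝔭, -⟩ := Ideal.exists_minimalPrimes_le
    (bot_le : (⊥ : Ideal S') ≤ IsLocalRing.maximalIdeal S')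
  have : 𝔭.IsPrime := h𝔭.1.1
  have hloc : IsLocalRing (S' ⧸ 𝔭) :=
    IsLocalRing.of_surjective' (Ideal.Quotient.mk 𝔭) Ideal.Quotient.mk_surjective
  refine ⟨S' ⧸ 𝔭, inferInstance, inferInstance, hloc,
    (Ideal.Quotient.mk 𝔭).comp (algebraMap S S'), ?_, ⟨fun r hr => ?_⟩⟩
  · rw [injective_iff_map_eq_zero]
    intro r hr
    by_contra hr0
    have hmem : algebraMap R S' r ∈ 𝔭 := by
      rw [← Ideal.Quotient.eq_zero_iff_mem, IsScalarTower.algebraMap_apply R S S']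
      exact hr
    refine notMem_nonZeroDivisors_of_mem_mem_minimalPrimes hmem h𝔭 ?_
    have hreg := Module.Flat.isSMulRegular_of_nonZeroDivisors (M := S')
      (mem_nonZeroDivisors_of_ne_zero hr0)
    refine mem_nonZeroDivisors_iff_right.2 fun z hz => hreg ?_
    change r • z = r • 0
    rw [smul_zero, Algebra.smul_def, mul_comm, hz]
  · by_contra hu
    have h1 : r ∈ IsLocalRing.maximalIdeal R := hu
    have h2 : algebraMap R S r ∈ q.asIdeal := by
      have : r ∈ (PrimeSpectrum.comap (algebraMap R S) q).asIdeal := by rw [hq]; exact h1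
      exact this
    have h3 : algebraMap S S' (algebraMap R S r) ∈ IsLocalRing.maximalIdeal S' :=
      (IsLocalization.AtPrime.to_map_mem_maximal_iff S' q.asIdeal _).2 h2
    have hle : 𝔭 ≤ IsLocalRing.maximalIdeal S' := IsLocalRing.le_maximalIdeal h𝔭.1.1.ne_top
    have h4 := Ideal.mem_map_of_mem (Ideal.Quotient.mk 𝔭) h3
    have h5 := Ideal.eq_top_of_isUnit_mem _ h4 hr
    have h6 := congrArg (Ideal.comap (Ideal.Quotient.mk 𝔭)) h5
    rw [Ideal.comap_map_of_surjective _ Ideal.Quotient.mk_surjective, Ideal.comap_top,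
      ← RingHom.ker_eq_comap_bot, Ideal.mk_ker, sup_eq_left.2 hle] at h6
    exact (IsLocalRing.maximalIdeal.isMaximal S').ne_top h6

open TensorProduct in
/-- A point of `Gr_j(P) / PGL_n` over a local domain `R` which lies over `Spec K` comes, over a
local domain dominating `R`, from a frame over a pull-back of the point `x` of `X` over the
extension `L` of `K`. -/
theorem exists_framedImage_lift {n p j : ℕ} {w : ℤ} {F : CommAlgCat.{u} k ⥤ Type u} [PGLAction n F]
    {Z : Scheme.{u}} [Z.Over (Spec (.of k))] {γ : F ⟶ points k Z} (hγ : IsPGLQuotient n γ)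
    {K : Type u} [Field K] [Algebra k K] {L : CommAlgCat.{u} k} [Nontrivial L] [Algebra K L]
    [IsScalarTower k K L] {x : F.obj L} {y : (points k Z).obj (.of k K)}
    (hx : γ.app _ x = (points k Z).map (structureMap K L) y)
    {P : WeightedBundle n w F p} (b : Module.Basis (Fin p) L (P.fiber x))
    {ZP : Scheme.{u}} [ZP.Over (Spec (.of k))] {π : P.gr j ⟶ points k ZP} (hπ : IsPGLQuotient n π)
    {φ : points k ZP ⟶ points k Z} (hφ : π ≫ φ = P.grProj j ≫ γ) (hj : j ≤ p)
    {R : CommAlgCat.{u} k} [IsDomain R] [IsLocalRing R] (ι : CommAlgCat.of k K ⟶ R)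
    (z : (points k ZP).obj R) (hz : φ.app R z = (points k Z).map ι y) :
    ∃ (D : CommAlgCat.{u} k) (_ : IsDomain D) (_ : IsLocalRing D) (ψ : R ⟶ D),
      Function.Injective ψ.hom ∧ IsLocalHom ψ.hom.toRingHom ∧
      ∃ (f : L ⟶ D) (u : Matrix (Fin p) (Fin j) D) (hu : IsFrame u),
        (points k ZP).map ψ z = framedImage b π f u hu := by
  obtain ⟨R', f₀, a, hff, -, ha⟩ := hπ.locally_surjective z
  let : Algebra K R' := (ι ≫ f₀).hom.toRingHom.toAlgebra
  have : IsScalarTower k K R' := IsScalarTower.of_algebraMap_eq fun t =>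
    ((ι ≫ f₀).hom.commutes t).symm
  let i₁ : R' ⟶ CommAlgCat.of k (R' ⊗[K] L) := CommAlgCat.ofHom Algebra.TensorProduct.includeLeft
  let i₂ : L ⟶ CommAlgCat.of k (R' ⊗[K] L) := CommAlgCat.ofHom
    ((Algebra.TensorProduct.includeRight : L →ₐ[K] R' ⊗[K] L).restrictScalars k)
  have hff' : (algebraMap R' (R' ⊗[K] L)).FaithfullyFlat :=
    (RingHom.faithfullyFlat_algebraMap_iff).2 inferInstance
  let : Algebra R (R' ⊗[K] L) := ((algebraMap R' (R' ⊗[K] L)).comp f₀.hom.toRingHom).toAlgebra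
  have : Module.FaithfullyFlat R (R' ⊗[K] L) :=
    (RingHom.faithfullyFlat_algebraMap_iff).1
      (RingHom.FaithfullyFlat.stableUnderComposition _ _ hff hff')
  obtain ⟨D, _, _, _, χ, hinj, hloc⟩ := exists_local_domain_of_faithfullyFlat (R := R)
    (S := R' ⊗[K] L)
  let : Algebra k D := (χ.comp (algebraMap k (R' ⊗[K] L))).toAlgebra
  let χ' : CommAlgCat.of k (R' ⊗[K] L) ⟶ CommAlgCat.of k D :=
    CommAlgCat.ofHom { χ with commutes' := fun t => rfl }
  let ψ : R ⟶ CommAlgCat.of k D := f₀ ≫ i₁ ≫ χ'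
  let f : L ⟶ CommAlgCat.of k D := i₂ ≫ χ'
  have : IsLocalRing (CommAlgCat.of k D) := ‹IsLocalRing D›
  have hKL : structureMap K L ≫ f = ι ≫ ψ := by
    ext t
    exact congrArg χ (Algebra.TensorProduct.tmul_one_eq_one_tmul t).symm
  -- The lift of `z` to `D`, which is moved over the pull-back of `x` by an element of `GL_n(D)`.
  let a' : P.GrPoint j (.of k D) := (P.gr j).map (i₁ ≫ χ') a
  have ha' : π.app (.of k D) a' = (points k ZP).map ψ z := by
    refine (NatTrans.naturality_apply π (i₁ ≫ χ') a).trans ?_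
    rw [ha, map_comp_apply]
  have hbase : γ.app (.of k D) a'.base = γ.app _ (F.map f x) := by
    have h1 : γ.app (.of k D) a'.base = φ.app _ (π.app (.of k D) a') :=
      (congrArg (fun (t : P.gr j ⟶ points k Z) => t.app (.of k D) a') hφ).symm
    rw [h1, ha', NatTrans.naturality_apply, NatTrans.naturality_apply, hz, hx, map_comp_apply,
      map_comp_apply, hKL]
  obtain ⟨g, hg⟩ := hγ.exists_smul_eq_of_isLocalRing (T := .of k D) hbase
  obtain ⟨u, hu, e⟩ := P.exists_framedPoint_eq b f hj (P.grSMul g a') hg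
  refine ⟨.of k D, ‹_›, ‹_›, ψ, hinj, hloc, f, u, hu, ?_⟩
  rw [← ha']
  exact ((hπ.invariant g a').symm).trans (congrArg (π.app (.of k D)) e.symm)

/-! ### Local rings of a scheme and their points -/

variable (k) in
/-- The structure of a `k`-algebra on the local rings of a `k`-scheme. -/
@[reducible]
def stalkAlgebra (Z : Scheme.{u}) [Z.Over (Spec (.of k))] (s : Z) :
    Algebra k (Z.presheaf.stalk s) :=
  (Spec.preimage (Z.fromSpecStalk s ≫ Z ↘ Spec (.of k))).hom.toAlgebra

variable (k) in
/-- The local ring of a `k`-scheme at a point. -/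
def stalkAlg (Z : Scheme.{u}) [Z.Over (Spec (.of k))] (s : Z) : CommAlgCat.{u} k :=
  letI := stalkAlgebra k Z s
  CommAlgCat.of k (Z.presheaf.stalk s)

variable (k) in
/-- The point of a `k`-scheme with values in its local ring at a point. -/
def stalkPoint (Z : Scheme.{u}) [Z.Over (Spec (.of k))] (s : Z) :
    (points k Z).obj (stalkAlg k Z s) :=
  ⟨Z.fromSpecStalk s, (Spec.map_preimage _).symm⟩

instance (Z : Scheme.{u}) [Z.Over (Spec (.of k))] (s : Z) : IsLocalRing (stalkAlg k Z s) :=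
  inferInstanceAs (IsLocalRing (Z.presheaf.stalk s))

instance (Z : Scheme.{u}) [Z.Over (Spec (.of k))] [IsIntegral Z] (s : Z) :
    IsDomain (stalkAlg k Z s) :=
  inferInstanceAs (IsDomain (Z.presheaf.stalk s))

instance (Z : Scheme.{u}) [Z.Over (Spec (.of k))] (s : Z) : Mono (stalkPoint k Z s).1 :=
  inferInstanceAs (Mono (Z.fromSpecStalk s))

/-- The image of the closed point under a point with values in a local ring. -/
def center {Z : Scheme.{u}} [Z.Over (Spec (.of k))] {R : CommAlgCat.{u} k} [IsLocalRing R]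
    (z : (points k Z).obj R) : Z :=
  z.1 (IsLocalRing.closedPoint R)

theorem center_stalkPoint (Z : Scheme.{u}) [Z.Over (Spec (.of k))] (s : Z) :
    center (stalkPoint k Z s) = s :=
  Scheme.fromSpecStalk_closedPoint

theorem center_map {Z : Scheme.{u}} [Z.Over (Spec (.of k))] {R R' : CommAlgCat.{u} k}
    [IsLocalRing R] [IsLocalRing R'] (f : R ⟶ R') [IsLocalHom f.hom.toRingHom]
    (z : (points k Z).obj R) : center ((points k Z).map f z) = center z := by
  have h := IsLocalRing.comap_closedPoint f.hom.toRingHom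
  exact congrArg z.1 h

theorem center_pointsMap {Z Y : Scheme.{u}} [Z.Over (Spec (.of k))] [Y.Over (Spec (.of k))]
    (φ : Z ⟶ Y) [φ.IsOver (Spec (.of k))] {R : CommAlgCat.{u} k} [IsLocalRing R]
    (z : (points k Z).obj R) : center ((pointsMap k φ).app R z) = φ (center z) :=
  rfl

/-- A point with values in a local ring factors through the local ring at its center. -/
theorem exists_map_stalkPoint_eq {Z : Scheme.{u}} [Z.Over (Spec (.of k))] {R : CommAlgCat.{u} k}
    [IsLocalRing R] (z : (points k Z).obj R) {s : Z} (hs : center z = s) :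
    ∃ σ : stalkAlg k Z s ⟶ R, IsLocalHom σ.hom.toRingHom ∧
      (points k Z).map σ (stalkPoint k Z s) = z := by
  subst hs
  have : IsLocalRing (CommRingCat.of R) := ‹_›
  let τ : Z.presheaf.stalk (center z) ⟶ .of R := Scheme.stalkClosedPointTo (R := .of R) z.1
  have hτ : Spec.map τ ≫ Z.fromSpecStalk (center z) = z.1 :=
    Scheme.Spec_stalkClosedPointTo_fromSpecStalk (R := .of R) z.1
  let := stalkAlgebra k Z (center z)
  -- The homomorphism from the local ring is compatible with the structures of `k`-algebras.
  have hk : CommRingCat.ofHom (algebraMap k (Z.presheaf.stalk (center z))) ≫ τ =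
      CommRingCat.ofHom (algebraMap k R) := by
    have h1 : Spec.map (CommRingCat.ofHom (algebraMap k (Z.presheaf.stalk (center z)))) =
      Z.fromSpecStalk (center z) ≫ Z ↘ Spec (.of k) := Spec.map_preimage _
    apply Spec.map_injective
    rw [← z.2, ← hτ, Category.assoc, ← h1]
    exact Spec.map_comp _ _
  let σ : stalkAlg k Z (center z) ⟶ R := CommAlgCat.ofHom
    { τ.hom with commutes' := fun t => congrArg (fun h => h.hom t) hk }
  have hloc : IsLocalHom τ.hom :=
    Scheme.isLocalHom_stalkClosedPointTo' (R := R) z.1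
  exact ⟨σ, hloc, Subtype.ext hτ⟩

/-- Over an irreducible scheme, a point with values in a domain is centered at the generic
point if it becomes so over some field. -/
theorem center_eq_genericPoint_of_map {Z : Scheme.{u}} [Z.Over (Spec (.of k))] [IsIntegral Z]
    {R M Ω : CommAlgCat.{u} k} [IsDomain R] [IsLocalRing M] [IsLocalRing Ω] (z : (points k Z).obj R)
    (f : R ⟶ M) (hf : Function.Injective f.hom) (hM : IsField M) (g : R ⟶ Ω)
    (hg : center ((points k Z).map g z) = genericPoint Z) :
    center ((points k Z).map f z) = genericPoint Z := by
  have h1 : PrimeSpectrum.comap f.hom.toRingHom (IsLocalRing.closedPoint M) ⤳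
      PrimeSpectrum.comap g.hom.toRingHom (IsLocalRing.closedPoint Ω) := by
    rw [← PrimeSpectrum.le_iff_specializes]
    intro r hr
    have h0 : f.hom r = 0 := by
      by_contra h0
      obtain ⟨s, hs⟩ := hM.mul_inv_cancel h0
      exact hr (IsUnit.of_mul_eq_one s hs)
    rw [(map_eq_zero_iff f.hom hf).1 h0]
    exact Ideal.zero_mem _
  have h2 := h1.map z.1.continuous
  have h3 : z.1 (PrimeSpectrum.comap g.hom.toRingHom (IsLocalRing.closedPoint Ω)) =
    genericPoint Z := hg
  rw [h3] at h2
  exact (h2.antisymm (genericPoint_specializes _)).eq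

/-- If the local ring at `s` is a field, then `s` is the generic point. -/
theorem eq_genericPoint_of_isField {Z : Scheme.{u}} [Z.Over (Spec (.of k))] [IsIntegral Z] {s : Z}
    (h : IsField (stalkAlg k Z s)) : s = genericPoint Z := by
  have h1 : genericPoint Z ∈ Set.range (Z.fromSpecStalk s) := by
    rw [Scheme.range_fromSpecStalk]
    exact genericPoint_specializes s
  obtain ⟨t, ht⟩ := h1
  let : Field (Z.presheaf.stalk s) := IsField.toField h
  have h2 : Subsingleton (PrimeSpectrum (Z.presheaf.stalk s)) := inferInstance
  refine (Scheme.fromSpecStalk_closedPoint (X := Z) (x := s)).symm.trans (Eq.trans ?_ ht)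
  exact congrArg _ (Subsingleton.elim (α := PrimeSpectrum (Z.presheaf.stalk s)) _ _)

/-! ### Extensions of fields and local rings -/

open TensorProduct in
/-- In `E ⊗[K] E`, the elements `e ⊗ 1` and `1 ⊗ e` agree only if `e` belongs to the field `K`. -/
theorem exists_algebraMap_eq_of_tmul_eq {K E : Type*} [Field K] [Field E] [Algebra K E] {e : E}
    (h : e ⊗ₜ[K] (1 : E) = 1 ⊗ₜ e) : ∃ a, algebraMap K E a = e := by
  by_contra hc
  have h1 : e ∉ Submodule.span K {(1 : E)} := fun he => by
    obtain ⟨a, ha⟩ := Submodule.mem_span_singleton.1 he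
    exact hc ⟨a, by rw [← ha, Algebra.smul_def, mul_one]⟩
  obtain ⟨l, hl, hle⟩ := Submodule.exists_le_ker_of_notMem h1
  have h2 : l 1 = 0 := hle (Submodule.mem_span_singleton_self 1)
  have h3 := congrArg ((TensorProduct.lid K E) ∘ (l.rTensor E)) h
  simp only [Function.comp, LinearMap.rTensor_tmul, TensorProduct.lid_tmul, h2, zero_smul] at h3
  exact hl (by simpa using h3)

open TensorProduct in
/-- Two extensions of a field have a common extension. -/
theorem exists_common_extension {K M N : CommAlgCat.{u} k} (hK : IsField K) [Nontrivial M]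
    [Nontrivial N] (f : K ⟶ M) (g : K ⟶ N) :
    ∃ (Ω : Type u) (_ : Field Ω) (_ : Algebra k Ω) (f' : M ⟶ .of k Ω) (g' : N ⟶ .of k Ω),
      f ≫ f' = g ≫ g' := by
  let : Field K := hK.toField
  let : Algebra K M := f.hom.toRingHom.toAlgebra
  let : Algebra K N := g.hom.toRingHom.toAlgebra
  have : IsScalarTower k K M := IsScalarTower.of_algebraMap_eq fun t => (f.hom.commutes t).symm
  obtain ⟨m, hm⟩ := Ideal.exists_maximal (M ⊗[K] N)
  let : Field (M ⊗[K] N ⧸ m) := Ideal.Quotient.field m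
  refine ⟨M ⊗[K] N ⧸ m, inferInstance, inferInstance,
    CommAlgCat.ofHom ((Ideal.Quotient.mkₐ k m).comp
      Algebra.TensorProduct.includeLeft),
    CommAlgCat.ofHom ((Ideal.Quotient.mkₐ k m).comp
      { Algebra.TensorProduct.includeRight.toRingHom with
        commutes' := fun t => ?_ }), ?_⟩
  · have h1 : algebraMap k N t = g.hom (algebraMap k K t) := (g.hom.commutes t).symm
    have h2 : algebraMap k M t = f.hom (algebraMap k K t) := (f.hom.commutes t).symm
    change (1 : M) ⊗ₜ[K] algebraMap k N t = algebraMap k M t ⊗ₜ 1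
    rw [h1, h2]
    exact (Algebra.TensorProduct.tmul_one_eq_one_tmul _).symm
  · ext t
    exact congrArg (Ideal.Quotient.mk m) (Algebra.TensorProduct.tmul_one_eq_one_tmul t)

instance (E : Type u) [Field E] [Algebra k E] : IsLocalRing (CommAlgCat.of k E) :=
  inferInstanceAs (IsLocalRing E)

open TensorProduct in
/-- For an extension `ψ : K → E` of fields, the two maps from `E` to `E ⊗[K] E` agree only on
`K`. -/
theorem exists_equalizer {K E : Type u} [Field K] [Field E] [Algebra k K] [Algebra k E]
    (ψ : CommAlgCat.of k K ⟶ .of k E) :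
    ∃ (T : CommAlgCat.{u} k) (i₁ i₂ : .of k E ⟶ T), ψ ≫ i₁ = ψ ≫ i₂ ∧
      ∀ e : E, i₁.hom e = i₂.hom e → ∃ a : K, ψ.hom a = e := by
  let : Algebra K E := ψ.hom.toRingHom.toAlgebra
  have : IsScalarTower k K E := IsScalarTower.of_algebraMap_eq fun t => (ψ.hom.commutes t).symm
  refine ⟨.of k (E ⊗[K] E), CommAlgCat.ofHom Algebra.TensorProduct.includeLeft,
    CommAlgCat.ofHom ((Algebra.TensorProduct.includeRight : E →ₐ[K] E ⊗[K] E).restrictScalars k),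
    ?_, fun e he => exists_algebraMap_eq_of_tmul_eq he⟩
  ext t
  exact Algebra.TensorProduct.tmul_one_eq_one_tmul t

/-- A homomorphism to `E` with values in the subfield `K` factors through `K`. -/
theorem exists_comp_eq {K E : Type u} [Field K] [Field E] [Algebra k K] [Algebra k E]
    (ψ : CommAlgCat.of k K ⟶ .of k E) {R : CommAlgCat.{u} k} (τ : R ⟶ .of k E)
    (h : ∀ r : R, ∃ a : K, ψ.hom a = τ.hom r) : ∃ σ : R ⟶ .of k K, σ ≫ ψ = τ := by
  let e : K ≃ₐ[k] ψ.hom.range := AlgEquiv.ofInjective ψ.hom ψ.hom.toRingHom.injective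
  refine ⟨CommAlgCat.ofHom (e.symm.toAlgHom.comp (τ.hom.codRestrict ψ.hom.range h)), ?_⟩
  ext r
  exact congrArg Subtype.val (e.apply_symm_apply _)

/-- Two local extensions of a local ring have a common extension over some field. -/
theorem exists_common_extension_of_isLocalHom {R M N : CommAlgCat.{u} k} [IsLocalRing R]
    [IsLocalRing M] [IsLocalRing N] (f : R ⟶ M) [IsLocalHom f.hom.toRingHom] (g : R ⟶ N)
    [IsLocalHom g.hom.toRingHom] :
    ∃ (Ω : Type u) (_ : Field Ω) (_ : Algebra k Ω) (f' : M ⟶ .of k Ω) (g' : N ⟶ .of k Ω),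
      f ≫ f' = g ≫ g' := by
  let res (A : CommAlgCat.{u} k) [IsLocalRing A] : A ⟶ .of k (IsLocalRing.ResidueField A) :=
    CommAlgCat.ofHom (IsScalarTower.toAlgHom k A (IsLocalRing.ResidueField A))
  let resMap {A B : CommAlgCat.{u} k} [IsLocalRing A] [IsLocalRing B] (h : A ⟶ B)
      [IsLocalHom h.hom.toRingHom] : CommAlgCat.of k (IsLocalRing.ResidueField A) ⟶
        .of k (IsLocalRing.ResidueField B) :=
    CommAlgCat.ofHom { IsLocalRing.ResidueField.map h.hom.toRingHom with
      commutes' := fun t => congrArg (IsLocalRing.residue B) (h.hom.commutes t) }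
  obtain ⟨Ω, _, _, f', g', h⟩ := exists_common_extension
    (K := .of k (IsLocalRing.ResidueField R)) (Field.toIsField _) (resMap f) (resMap g)
  refine ⟨Ω, ‹_›, ‹_›, res M ≫ f', res N ≫ g', ?_⟩
  ext r
  exact congrArg (fun h => h.hom (IsLocalRing.residue R r)) h

/-! ### Bases of fibres and finite extensions -/

/-- A fibre of a vector bundle over a local ring is free. -/
theorem VectorBundle.exists_basis {F : CommAlgCat.{u} k ⥤ Type u} {p : ℕ} (P : VectorBundle F p)
    {R : CommAlgCat.{u} k} [IsLocalRing R] (x : F.obj R) :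
    Nonempty (Module.Basis (Fin p) R (P.fiber x)) := by
  have : Module.Flat R (P.fiber x) := Module.Flat.of_projective
  have : Module.Free R (P.fiber x) := Module.free_of_flat_of_isLocalRing
  have h := P.rank_eq x (IsLocalRing.closedPoint R)
  rw [Module.rankAtStalk_eq_finrank_of_free] at h
  exact ⟨(Module.finBasis R (P.fiber x)).reindex (finCongr h)⟩

/-- A point of a quotient by `PGL_n` with values in a field lifts over a finite extension. -/
theorem IsPGLQuotient.exists_finite_extension {n : ℕ} {F : CommAlgCat.{u} k ⥤ Type u}
    [PGLAction n F] {Z : Scheme.{u}} [Z.Over (Spec (.of k))] {γ : F ⟶ points k Z}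
    (hγ : IsPGLQuotient n γ) {K : Type u} [Field K] [Algebra k K]
    (y : (points k Z).obj (.of k K)) :
    ∃ (L : CommAlgCat.{u} k) (_ : Algebra K L) (_ : IsScalarTower k K L) (_ : Module.Finite K L)
      (x : F.obj L), IsField L ∧ γ.app _ x = (points k Z).map (structureMap K L) y := by
  obtain ⟨R, f, x, hff, hfp, hx⟩ := hγ.locally_surjective y
  let : Algebra K R := f.hom.toRingHom.toAlgebra
  have : IsScalarTower k K R := IsScalarTower.of_algebraMap_eq fun t => (f.hom.commutes t).symm
  have : Nontrivial R := (RingHom.FaithfullyFlat.injective hff).nontrivial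
  have : Algebra.FinitePresentation K R := hfp
  obtain ⟨m, hm⟩ := Ideal.exists_maximal R
  let : Field (R ⧸ m) := Ideal.Quotient.field m
  have : Algebra.FiniteType K (R ⧸ m) :=
    Algebra.FiniteType.trans (S := R) inferInstance inferInstance
  let μ : R ⟶ .of k (R ⧸ m) := CommAlgCat.ofHom (Ideal.Quotient.mkₐ k m)
  refine ⟨.of k (R ⧸ m), inferInstanceAs (Algebra K (R ⧸ m)),
    inferInstanceAs (IsScalarTower k K (R ⧸ m)),
    finite_of_finite_type_of_isJacobsonRing K (R ⧸ m),
    F.map μ x, Field.toIsField (R ⧸ m), ?_⟩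
  rw [NatTrans.naturality_apply, hx, map_comp_apply]
  rfl

/-! ### The generic point of `Gr_j(P) / PGL_n` -/

/-- `y` exhibits the field `K` as the function field of the integral scheme `Y`: it is a
monomorphism `Spec K ⟶ Y` centered at the generic point, through which all points with values in
local rings centered there factor. -/
structure IsGenericPoint {Y : Scheme.{u}} [Y.Over (Spec (.of k))] [IsIntegral Y] {K : Type u}
    [Field K] [Algebra k K] (y : (points k Y).obj (.of k K)) : Prop where
  mono : Mono y.1
  center_eq : center y = genericPoint Y
  exists_map_eq {T : CommAlgCat.{u} k} [IsLocalRing T] (z : (points k Y).obj T)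
    (hz : center z = genericPoint Y) : ∃ σ : .of k K ⟶ T, (points k Y).map σ y = z

theorem isLocalHom_of_field {K : Type u} [Field K] [Algebra k K] {T : CommAlgCat.{u} k}
    [Nontrivial T] (σ : CommAlgCat.of k K ⟶ T) : IsLocalHom σ.hom.toRingHom :=
  inferInstance

section

variable {X Y : Scheme.{u}} [X.Over (Spec (.of k))] [Y.Over (Spec (.of k))]
  {n : ℕ} [PGLAction n (points k X)] {γ : X ⟶ Y} [γ.IsOver (Spec (.of k))]
  {K : Type u} [Field K] [Algebra k K] {y : (points k Y).obj (.of k K)}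
  {L : CommAlgCat.{u} k} [Algebra K L] [IsScalarTower k K L] {x : (points k X).obj L}
  {w : ℤ} {p q j : ℕ} {P : WeightedBundle n w (points k X) p}
  {Q : WeightedBundle n w (points k X) q}
  (b : Module.Basis (Fin p) L (P.fiber x)) (c : Module.Basis (Fin q) L (Q.fiber x))
  {ZP ZQ : Scheme.{u}} [ZP.Over (Spec (.of k))] [ZQ.Over (Spec (.of k))]
  {πP : P.gr j ⟶ points k ZP} {πQ : Q.gr j ⟶ points k ZQ}
  {φP : ZP ⟶ Y} [φP.IsOver (Spec (.of k))] {φQ : ZQ ⟶ Y} [φQ.IsOver (Spec (.of k))]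

theorem app_framedImage
    (hx : (pointsMap k γ).app _ x = (points k Y).map (structureMap K L) y)
    (hφ : πP ≫ pointsMap k φP = P.grProj j ≫ pointsMap k γ) {T : CommAlgCat.{u} k}
    (f : L ⟶ T) (u : Matrix (Fin p) (Fin j) T) (hu : IsFrame u) :
    (pointsMap k φP).app T (framedImage b πP f u hu) =
      (points k Y).map (structureMap K L ≫ f) y := by
  have h1 : (pointsMap k φP).app T (framedImage b πP f u hu) =
      (pointsMap k γ).app T ((points k X).map f x) :=
    congrArg (fun (t : P.gr j ⟶ points k Y) => t.app T (P.framedPoint b f u hu)) hφ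
  rw [h1, NatTrans.naturality_apply, hx, map_comp_apply]

theorem center_app_framedImage [IsIntegral Y] (hy : IsGenericPoint y)
    (hx : (pointsMap k γ).app _ x = (points k Y).map (structureMap K L) y)
    (hφ : πP ≫ pointsMap k φP = P.grProj j ≫ pointsMap k γ) {T : CommAlgCat.{u} k} [IsLocalRing T]
    (f : L ⟶ T) (u : Matrix (Fin p) (Fin j) T) (hu : IsFrame u) :
    φP (center (framedImage b πP f u hu)) = genericPoint Y := by
  have := isLocalHom_of_field (structureMap K L ≫ f)
  rw [← center_pointsMap, app_framedImage b hx hφ, center_map, hy.center_eq]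

/-- The projection `Gr_j(P) / PGL_n → Y` is dominant. -/
theorem map_genericPoint_eq [IsIntegral Y] [IsIntegral ZP] (hy : IsGenericPoint y)
    (hx : (pointsMap k γ).app _ x = (points k Y).map (structureMap K L) y)
    (hφ : πP ≫ pointsMap k φP = P.grProj j ≫ pointsMap k γ) (hj : j ≤ p)
    [IsLocalRing L] :
    φP (genericPoint ZP) = genericPoint Y := by
  have hu : IsFrame (R := L) ((1 : Matrix (Fin p) (Fin p) L).submatrix id (Fin.castLE hj)) :=
    IsFrame.submatrix ⟨1, Matrix.one_mul 1⟩ (Fin.castLE_injective hj)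
  obtain ⟨b⟩ := P.exists_basis x
  have h := center_app_framedImage b hy hx hφ (𝟙 _) _ hu
  have h1 := (genericPoint_specializes (center (framedImage b πP (𝟙 _) _ hu))).map φP.continuous
  rw [h] at h1
  exact (h1.antisymm (genericPoint_specializes _)).eq

/-- The generic point of `Gr_j(P) / PGL_n` is the graph of a family of homomorphisms, with
coefficients in the function field `KP`, over a subspace of `Q` whose image in
`Gr_j(Q) / PGL_n` is defined over `KP` as well. -/
theorem exists_generic_graph [IsIntegral Y] [IsIntegral ZP] [Infinite K] [Module.Finite K L]
    (hL : IsField L) (hy : IsGenericPoint y)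
    (hγ : IsPGLQuotient n (pointsMap k γ))
    (hx : (pointsMap k γ).app _ x = (points k Y).map (structureMap K L) y)
    (hπP : IsPGLQuotient n πP) (hπQ : IsPGLQuotient n πQ)
    (hφP : πP ≫ pointsMap k φP = P.grProj j ≫ pointsMap k γ)
    (hφQ : πQ ≫ pointsMap k φQ = Q.grProj j ≫ pointsMap k γ) (hjq : j ≤ q) (hqp : q ≤ p)
    {KP : Type u} [Field KP] [Algebra k KP] {z : (points k ZP).obj (.of k KP)}
    (hz : IsGenericPoint z) :
    ∃ (E : Type u) (_ : Field E) (_ : Algebra k E) (ψ : CommAlgCat.of k KP ⟶ .of k E)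
      (f : L ⟶ .of k E) (κ : Type) (_ : Fintype κ) (S : Slice b c κ)
      (v : Matrix (Fin q) (Fin j) E) (hv : IsFrame v) (t : κ → KP),
      LinearIndependent E (fun i => (S.shift i).map f.hom * v) ∧
      (points k ZP).map ψ z =
        graphImage πP S f (fun i => ψ.hom (t i)) v hv ∧
      ∃ (s : ZQ) (σ : stalkAlg k ZQ s ⟶ .of k KP), φQ s = genericPoint Y ∧
        IsLocalHom σ.hom.toRingHom ∧
        (points k ZQ).map (σ ≫ ψ) (stalkPoint k ZQ s) = framedImage c πQ f v hv := by
  have : Nontrivial L := hL.nontrivial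
  let : Field L := hL.toField
  have hlocL : IsLocalRing L := inferInstance
  have := hy.mono
  have := hz.mono
  have hzY : φP (center z) = genericPoint Y := by
    rw [hz.center_eq, map_genericPoint_eq hy hx hφP (hjq.trans hqp)]
  obtain ⟨ι, hι⟩ := hy.exists_map_eq ((pointsMap k φP).app _ z) hzY
  have : IsDomain (CommAlgCat.of k KP) := inferInstanceAs (IsDomain KP)
  obtain ⟨D, _, _, ψ₀, -, -, f₀, u₀, hu₀, e₀⟩ :=
    exists_framedImage_lift hγ hx b hπP hφP (hjq.trans hqp) ι z hι.symm
  obtain ⟨E, _, _, ψ, f, u, hu, e₁⟩ : ∃ (E : Type u) (_ : Field E) (_ : Algebra k E)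
      (ψ : CommAlgCat.of k KP ⟶ .of k E) (f : L ⟶ .of k E) (u : Matrix (Fin p) (Fin j) E)
      (hu : IsFrame u), (points k ZP).map ψ z = framedImage b πP f u hu := by
    let μ : D ⟶ .of k (FractionRing D) :=
      CommAlgCat.ofHom (IsScalarTower.toAlgHom k D (FractionRing D))
    refine ⟨FractionRing D, inferInstance, inferInstance, ψ₀ ≫ μ, f₀ ≫ μ, u₀.map μ.hom,
      hu₀.map μ.hom.toRingHom, ?_⟩
    rw [← map_comp_apply, e₀, map_framedImage]
  obtain ⟨κ, _, S, v, tE, hv, hli, rfl⟩ :=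
    exists_slice b c hγ hx hL hjq hqp f.hom.toRingHom u hu
  change (points k ZP).map ψ z = graphImage πP S f tE v hv at e₁
  -- The coefficients and the projection have the same pull-backs to `E ⊗ E` over `KP`.
  obtain ⟨T, i₁, i₂, hi, hT⟩ := exists_equalizer ψ
  have e₂ := congrArg ((points k ZP).map i₁) e₁
  rw [map_comp_apply, hi, ← map_comp_apply, e₁, map_graphImage, map_graphImage] at e₂
  replace e₂ := e₂.symm
  have e₃ := framedImage_eq_of_graphImage_eq S hπP hπQ _ _ e₂
  have e₄ := coeff_eq_of_graphImage_eq S hv hli hπP i₂ _ e₂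
  choose t ht using fun i => hT (tE i) (congrFun e₄ i)
  obtain rfl : (fun i => ψ.hom (t i)) = tE := funext ht
  obtain ⟨τ, hτ, eτ⟩ := exists_map_stalkPoint_eq (framedImage c πQ f v hv) rfl
  have e₅ : τ ≫ i₁ = τ ≫ i₂ := by
    refine eq_of_points_map_eq (stalkPoint k ZQ _) ?_
    rw [← map_comp_apply, ← map_comp_apply, eτ, map_framedImage, map_framedImage]
    exact e₃
  obtain ⟨σ, rfl⟩ := exists_comp_eq ψ τ fun r => hT _ (congrArg (fun h => h.hom r) e₅)
  refine ⟨E, inferInstance, inferInstance, ψ, f, κ, inferInstance, S, v, hv, t, hli, e₁, _, σ,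
    center_app_framedImage c hy hx hφQ f v hv, ?_, eτ⟩
  have : IsLocalHom (ψ.hom.toRingHom.comp σ.hom.toRingHom) := hτ
  exact isLocalHom_of_comp σ.hom.toRingHom ψ.hom.toRingHom

/-- The function field of `Gr_j(P) / PGL_n` is generated by the coefficients of the generic graph
and by the field of definition of its projection. -/
theorem adjoin_eq_top_of_graph
    (hπP : IsPGLQuotient n πP) (hπQ : IsPGLQuotient n πQ)
    {KP : Type u} [Field KP] [Algebra k KP] {z : (points k ZP).obj (.of k KP)} [Mono z.1]
    {E : Type u} [Field E] [Algebra k E] {ψ : CommAlgCat.of k KP ⟶ .of k E}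
    {f : L ⟶ .of k E} {κ : Type} [Fintype κ] (S : Slice b c κ)
    {v : Matrix (Fin q) (Fin j) E} (hv : IsFrame v) (t : κ → KP)
    (h : (points k ZP).map ψ z =
        graphImage πP S f (fun i => ψ.hom (t i)) v hv)
    {R : CommAlgCat.{u} k} {σ : R ⟶ .of k KP} {s : (points k ZQ).obj R}
    (hs : (points k ZQ).map (σ ≫ ψ) s = framedImage c πQ f v hv) :
    IntermediateField.adjoin k (Set.range σ.hom ∪ Set.range t) = ⊤ := by
  let N := IntermediateField.adjoin k (Set.range σ.hom ∪ Set.range t)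
  change N = ⊤
  let ν : CommAlgCat.of k N ⟶ .of k KP := CommAlgCat.ofHom N.val
  have hν : ∀ a ∈ N, ∃ a' : N, ν.hom a' = a := fun a ha => ⟨⟨a, ha⟩, rfl⟩
  obtain ⟨T, i₁, i₂, hi, hT⟩ := exists_equalizer (ν ≫ ψ)
  have hN : ∀ a ∈ N, i₁.hom (ψ.hom a) = i₂.hom (ψ.hom a) := fun a ha => by
    obtain ⟨a', rfl⟩ := hν a ha
    exact congrArg (fun h => h.hom a') hi
  have hσ : (σ ≫ ψ) ≫ i₁ = (σ ≫ ψ) ≫ i₂ := by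
    ext r
    exact hN _ (IntermediateField.subset_adjoin _ _ (Or.inl ⟨r, rfl⟩))
  have ht : (fun i => i₁.hom (ψ.hom (t i))) = fun i => i₂.hom (ψ.hom (t i)) :=
    funext fun i => hN _ (IntermediateField.subset_adjoin _ _ (Or.inr ⟨i, rfl⟩))
  have e₁ : framedImage c πQ (f ≫ i₁) (v.map i₁.hom) (hv.map i₁.hom.toRingHom) =
      framedImage c πQ (f ≫ i₂) (v.map i₂.hom) (hv.map i₂.hom.toRingHom) := by
    rw [← map_framedImage c f v hv i₁, ← map_framedImage c f v hv i₂, ← hs,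
      map_comp_apply, map_comp_apply, hσ]
  have e₂ := graphImage_eq S hπP hπQ (fun i => i₁.hom (ψ.hom (t i))) (hv.map i₁.hom.toRingHom)
    (hv.map i₂.hom.toRingHom) e₁
  have e₃ : ψ ≫ i₁ = ψ ≫ i₂ := by
    refine eq_of_points_map_eq z ?_
    rw [← map_comp_apply, ← map_comp_apply, h, map_graphImage, map_graphImage, ← ht]
    exact e₂
  refine eq_top_iff.2 fun a _ => ?_
  obtain ⟨a', ha'⟩ := hT _ (congrArg (fun h => h.hom a) e₃)
  have : ν.hom a' = a := ψ.hom.toRingHom.injective ha'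
  exact this ▸ a'.2

/-- The coefficients `t` of the generic graph are algebraically independent over the local ring of
`Gr_j(Q) / PGL_n` at the image `s` of the generic graph. It is not assumed that `s` is the generic
point, and polynomials of degree `0` show that the local ring embeds in `KP`. -/
theorem eq_zero_of_eval₂_eq_zero [IsIntegral Y] [IsIntegral ZP] [IsIntegral ZQ] [Nontrivial L]
    (hy : IsGenericPoint y)
    (hγ : IsPGLQuotient n (pointsMap k γ))
    (hx : (pointsMap k γ).app _ x = (points k Y).map (structureMap K L) y)
    (hπP : IsPGLQuotient n πP) (hπQ : IsPGLQuotient n πQ)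
    (hφQ : πQ ≫ pointsMap k φQ = Q.grProj j ≫ pointsMap k γ) (hjq : j ≤ q)
    {KP : Type u} [Field KP] [Algebra k KP] {z : (points k ZP).obj (.of k KP)}
    (hz : IsGenericPoint z)
    {E : Type u} [Field E] [Algebra k E] {ψ : CommAlgCat.of k KP ⟶ .of k E}
    {f : L ⟶ .of k E} {κ : Type} [Fintype κ] (S : Slice b c κ)
    {v : Matrix (Fin q) (Fin j) E} (hv : IsFrame v) (t : κ → KP)
    (hli : LinearIndependent E (fun i => (S.shift i).map f.hom * v))
    (h : (points k ZP).map ψ z =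
        graphImage πP S f (fun i => ψ.hom (t i)) v hv)
    {s : ZQ} (hs : φQ s = genericPoint Y) {σ : stalkAlg k ZQ s ⟶ .of k KP}
    [IsLocalHom σ.hom.toRingHom]
    (hσ : (points k ZQ).map (σ ≫ ψ) (stalkPoint k ZQ s) = framedImage c πQ f v hv)
    (G : MvPolynomial κ (stalkAlg k ZQ s)) (hG : MvPolynomial.eval₂ σ.hom.toRingHom t G = 0) :
    G = 0 := by
  have := hy.mono
  have := hz.mono
  obtain ⟨ι, hι⟩ := hy.exists_map_eq ((pointsMap k φQ).app _ (stalkPoint k ZQ s)) (by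
    rw [center_pointsMap, center_stalkPoint, hs])
  obtain ⟨D, _, _, χ, hχ, hχloc, fD, vD, hvD, eD⟩ :=
    exists_framedImage_lift hγ hx c hπQ hφQ hjq ι (stalkPoint k ZQ s) hι.symm
  let A : CommAlgCat.{u} k := .of k (MvPolynomial κ D)
  let C : D ⟶ A := CommAlgCat.ofHom (IsScalarTower.toAlgHom k D (MvPolynomial κ D))
  let zA : (points k ZP).obj A := graphImage πP S (fD ≫ C) MvPolynomial.X (vD.map C.hom)
    (hvD.map C.hom.toRingHom)
  have map_zA : ∀ {T : CommAlgCat.{u} k} (e : A ⟶ T), (points k ZP).map e zA =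
      graphImage πP S (fD ≫ C ≫ e) (fun i => e.hom (MvPolynomial.X i)) (vD.map (C ≫ e).hom)
        (hvD.map (C ≫ e).hom.toRingHom) := fun e => map_graphImage S _ _ _ _ e
  have map_z : ∀ {T : CommAlgCat.{u} k} (e : .of k E ⟶ T), (points k ZP).map (ψ ≫ e) z =
      graphImage πP S (f ≫ e) (fun i => e.hom (ψ.hom (t i))) (v.map e.hom)
        (hv.map e.hom.toRingHom) := by
    intro T e
    rw [← map_comp_apply, h, map_graphImage]
  -- Evaluating the indeterminates at `t` specializes the graph over `A = D[X]` to the generic point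
  -- of `Gr_j(P) / PGL_n`.
  have hcenter : ∃ (Ω : Type u) (_ : Field Ω) (_ : Algebra k Ω) (ev : A ⟶ .of k Ω),
      center ((points k ZP).map ev zA) = genericPoint ZP := by
    have : IsLocalHom (σ ≫ ψ).hom.toRingHom :=
      RingHom.isLocalHom_comp ψ.hom.toRingHom σ.hom.toRingHom
    obtain ⟨Ω, _, _, α, β, hαβ⟩ := exists_common_extension_of_isLocalHom χ (σ ≫ ψ)
    let ev : A ⟶ .of k Ω := CommAlgCat.ofHom
      { MvPolynomial.eval₂Hom α.hom.toRingHom (fun i => β.hom (ψ.hom (t i))) with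
        commutes' := fun r => (MvPolynomial.eval₂_C _ _ _).trans (α.hom.commutes r) }
    have hC : C ≫ ev = α := by
      ext r
      exact MvPolynomial.eval₂_C _ _ _
    have hX : ∀ i, ev.hom (MvPolynomial.X i) = β.hom (ψ.hom (t i)) := fun i =>
      MvPolynomial.eval₂_X _ _ _
    refine ⟨Ω, inferInstance, inferInstance, ev, ?_⟩
    have e₁ : framedImage c πQ (fD ≫ α) (vD.map α.hom) (hvD.map α.hom.toRingHom) =
        framedImage c πQ (f ≫ β) (v.map β.hom) (hv.map β.hom.toRingHom) := by
      rw [← map_framedImage c fD vD hvD α, ← map_framedImage c f v hv β, ← eD, ← hσ,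
        map_comp_apply, map_comp_apply, hαβ]
    have e₂ := graphImage_eq S hπP hπQ (fun i => β.hom (ψ.hom (t i))) (hvD.map α.hom.toRingHom)
      (hv.map β.hom.toRingHom) e₁
    have e₃ : (points k ZP).map ev zA = (points k ZP).map (ψ ≫ β) z := by
      rw [map_zA, map_z]
      simp only [hC, hX]
      exact e₂
    have := isLocalHom_of_field (ψ ≫ β)
    rw [e₃, center_map, hz.center_eq]
  -- Hence the generic point of `Spec A` is mapped to the generic point as well.
  obtain ⟨Ω, _, _, ev, hev⟩ := hcenter
  have hA : IsDomain A := inferInstanceAs (IsDomain (MvPolynomial κ D))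
  let M := FractionRing A
  let μ : A ⟶ .of k M := CommAlgCat.ofHom (IsScalarTower.toAlgHom k A M)
  have hμ : Function.Injective μ.hom := IsFractionRing.injective A M
  obtain ⟨θ, hθ⟩ := hz.exists_map_eq ((points k ZP).map μ zA)
    (center_eq_genericPoint_of_map zA μ hμ (Field.toIsField M) ev hev)
  -- Over a common extension of `M` and `E`, the coefficients `t` are identified with the variables.
  obtain ⟨Ω', _, _, α, β, hαβ⟩ := exists_common_extension (Field.toIsField KP) θ ψ
  have e₁ : (points k ZP).map (μ ≫ α) zA = (points k ZP).map (ψ ≫ β) z := by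
    rw [← map_comp_apply, ← hθ, map_comp_apply, hαβ]
  rw [map_zA, map_z] at e₁
  have e₂ := framedImage_eq_of_graphImage_eq S hπP hπQ _ _ e₁
  have e₃ := coeff_eq_of_graphImage_eq S hv hli hπP β _ e₁
  have e₄ : χ ≫ C ≫ μ ≫ α = σ ≫ ψ ≫ β := by
    refine eq_of_points_map_eq (stalkPoint k ZQ s) ?_
    rw [← map_comp_apply, eD, map_framedImage, ← Category.assoc σ, ← map_comp_apply, hσ,
      map_framedImage c f v hv β]
    exact e₂
  have e₅ : (μ ≫ α).hom (MvPolynomial.map χ.hom.toRingHom G) =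
      (ψ ≫ β).hom (MvPolynomial.eval₂ σ.hom.toRingHom t G) := by
    have h₁ : ((μ ≫ α).hom.toRingHom.comp (MvPolynomial.map χ.hom.toRingHom)) =
        (ψ ≫ β).hom.toRingHom.comp (MvPolynomial.eval₂Hom σ.hom.toRingHom t) := by
      refine MvPolynomial.ringHom_ext (fun r => ?_) fun i => ?_
      · rw [RingHom.comp_apply, MvPolynomial.map_C, RingHom.comp_apply, MvPolynomial.eval₂Hom_C]
        exact congrArg (fun h => h.hom r) e₄
      · rw [RingHom.comp_apply, MvPolynomial.map_X, RingHom.comp_apply, MvPolynomial.eval₂Hom_X']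
        exact congrFun e₃ i
    exact congrArg (fun h => h G) h₁
  rw [hG, map_zero] at e₅
  have e₆ : μ.hom (MvPolynomial.map χ.hom.toRingHom G) = 0 :=
    (map_eq_zero_iff _ α.hom.toRingHom.injective).1 e₅
  refine MvPolynomial.map_injective _ hχ ?_
  rw [map_zero]
  exact hμ (e₆.trans (map_zero _).symm)

end

section

variable {X Y : Scheme.{u}} [X.Over (Spec (.of k))] [Y.Over (Spec (.of k))]
  {n : ℕ} [PGLAction n (points k X)] {γ : X ⟶ Y} [γ.IsOver (Spec (.of k))]
  {K : Type u} [Field K] [Algebra k K] {y : (points k Y).obj (.of k K)}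
  {w : ℤ} {p q j : ℕ} {P : WeightedBundle n w (points k X) p}
  {Q : WeightedBundle n w (points k X) q}
  {ZP ZQ : Scheme.{u}} [ZP.Over (Spec (.of k))] [ZQ.Over (Spec (.of k))]
  {πP : P.gr j ⟶ points k ZP} {πQ : Q.gr j ⟶ points k ZQ}
  {φP : ZP ⟶ Y} [φP.IsOver (Spec (.of k))] {φQ : ZQ ⟶ Y} [φQ.IsOver (Spec (.of k))]

/-! ### Function fields and rational maps -/

/-- The function field of `Gr_j(P) / PGL_n` is, over `Y`, purely transcendental over the function
field of `Gr_j(Q) / PGL_n`. -/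
theorem exists_algebraicIndependent_adjoin_eq_top [IsIntegral Y] [IsIntegral ZP] [IsIntegral ZQ]
    [Infinite K] (hy : IsGenericPoint y)
    (hγ : IsPGLQuotient n (pointsMap k γ))
    (hπP : IsPGLQuotient n πP) (hπQ : IsPGLQuotient n πQ)
    (hφP : πP ≫ pointsMap k φP = P.grProj j ≫ pointsMap k γ)
    (hφQ : πQ ≫ pointsMap k φQ = Q.grProj j ≫ pointsMap k γ) (hjq : j ≤ q) (hqp : q ≤ p)
    {KP : Type u} [Field KP] [Algebra k KP] {z : (points k ZP).obj (.of k KP)}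
    (hz : IsGenericPoint z) :
    ∃ (κ : Type) (t : κ → KP) (σ : stalkAlg k ZQ (genericPoint ZQ) ⟶ .of k KP),
      (∀ G, MvPolynomial.eval₂ σ.hom.toRingHom t G = 0 → G = 0) ∧
      IntermediateField.adjoin k (Set.range σ.hom ∪ Set.range t) = ⊤ ∧
      (pointsMap k φQ).app _ ((points k ZQ).map σ (stalkPoint k ZQ _)) =
        (pointsMap k φP).app _ z := by
  obtain ⟨L, _, _, _, x, hL, hx⟩ := hγ.exists_finite_extension y
  have : Nontrivial L := hL.nontrivial
  have : IsLocalRing L := by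
    let : Field L := hL.toField
    exact inferInstanceAs (IsLocalRing L)
  obtain ⟨b⟩ := P.exists_basis x
  obtain ⟨c⟩ := Q.exists_basis x
  obtain ⟨E, _, _, ψ, f, κ, _, S, v, hv, t, hli, h, s, σ, hs, _, hσ⟩ :=
    exists_generic_graph b c hL hy hγ hx hπP hπQ hφP hφQ hjq hqp hz
  have hind := eq_zero_of_eval₂_eq_zero b c hy hγ hx hπP hπQ hφQ hjq hz S hv t hli h hs hσ
  have hinj : ∀ r, σ.hom r = 0 → r = 0 := fun r hr => by
    have := hind (MvPolynomial.C r) ((MvPolynomial.eval₂_C _ _ _).trans hr)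
    rwa [MvPolynomial.C_eq_zero] at this
  -- The local ring at `s` embeds by a local homomorphism in a field, so that it is a field.
  obtain rfl : s = genericPoint ZQ := by
    refine eq_genericPoint_of_isField (k := k) ⟨⟨0, 1, zero_ne_one⟩, mul_comm, fun {r} hr => ?_⟩
    have h₁ : IsUnit (σ.hom.toRingHom r) := by
      have h₂ : (σ.hom r : KP) ≠ 0 := fun h₃ => hr (hinj r h₃)
      exact isUnit_iff_ne_zero.2 h₂
    exact (isUnit_of_map_unit σ.hom.toRingHom r h₁).exists_right_inv
  have := hy.mono
  have := hz.mono
  refine ⟨κ, t, σ, hind, adjoin_eq_top_of_graph b c hπP hπQ S hv t h hσ, ?_⟩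
  -- Both sides are centered at the generic point of `Y`, and agree after the injection `ψ`.
  have := isLocalHom_of_field ψ
  have e₁ : (points k Y).map ψ ((pointsMap k φQ).app _
      ((points k ZQ).map σ (stalkPoint k ZQ _))) =
      (points k Y).map ψ ((pointsMap k φP).app _ z) := by
    rw [← NatTrans.naturality_apply, ← NatTrans.naturality_apply, map_comp_apply, hσ, h,
      app_framedImage c hx hφQ, graphImage, app_framedImage b hx hφP]
  have e₂ : center ((pointsMap k φP).app _ z) = genericPoint Y := by
    rw [center_pointsMap, hz.center_eq, map_genericPoint_eq hy hx hφP (hjq.trans hqp)]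
  have e₃ : center ((pointsMap k φQ).app _ ((points k ZQ).map σ (stalkPoint k ZQ _))) =
      genericPoint Y := by
    rw [← center_map ψ, e₁, center_map, e₂]
  obtain ⟨α, hα⟩ := hy.exists_map_eq _ e₂
  obtain ⟨β, hβ⟩ := hy.exists_map_eq _ e₃
  rw [← hα, ← hβ, map_comp_apply, map_comp_apply] at e₁
  have e₄ := eq_of_points_map_eq y e₁
  have e₅ : β = α := by
    ext a
    exact ψ.hom.toRingHom.injective (congrArg (fun h => h.hom a) e₄)
  rw [← hα, ← hβ, e₅]

end

theorem isGenericPoint_stalkPoint (Z : Scheme.{u}) [Z.Over (Spec (.of k))] [IsIntegral Z] :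
    letI := stalkAlgebra k Z (genericPoint Z)
    IsGenericPoint (K := Z.functionField) (stalkPoint k Z (genericPoint Z)) := by
  let := stalkAlgebra k Z (genericPoint Z)
  exact ⟨inferInstanceAs (Mono (Z.fromSpecStalk _)), center_stalkPoint Z _, fun z hz =>
    (exists_map_stalkPoint_eq z hz).imp fun σ h => h.2⟩

/-- A rational map which sends the generic point to the generic point is dominant. -/
theorem isDominant_of_fromFunctionField {X Y : Scheme.{u}} [IsIntegral X] [IsIntegral Y]
    (ρ : X ⤏ Y) (s : Spec X.functionField) (h : ρ.fromFunctionField s = genericPoint Y) :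
    ρ.IsDominant := by
  obtain ⟨f, rfl⟩ := ρ.exists_rep
  rw [Scheme.PartialMap.isDominant_toRationalMap_iff]
  refine ⟨?_⟩
  have h₁ : genericPoint Y ∈ Set.range f.hom := by
    rw [← h]
    exact ⟨_, (Scheme.Hom.comp_apply _ _ _).symm⟩
  exact (dense_iff_closure_eq.2 (genericPoint_closure _)).mono (Set.singleton_subset_iff.2 h₁)

/-- A form of pure transcendence in which the base field enters as a set of generators. -/
theorem isPurelyTranscendental_of_adjoin_eq_top {K L : Type u} [Field K] [Field L] [Algebra k K]
    [Algebra k L] (σ : K →ₐ[k] L) {κ : Type} (t : κ → L)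
    (hind : ∀ G, MvPolynomial.eval₂ σ.toRingHom t G = 0 → G = 0)
    (htop : IntermediateField.adjoin k (Set.range σ ∪ Set.range t) = ⊤) :
    IsPurelyTranscendental σ.toRingHom := by
  let : Algebra K L := σ.toRingHom.toAlgebra
  have hK : ∀ a, algebraMap K L a = σ a := fun a => rfl
  refine ⟨ULift.{u} κ, fun i => t i.down,
    AlgebraicIndependent.comp (algebraicIndependent_iff.2 hind) _ ULift.down_injective, ?_⟩
  refine eq_top_iff.2 fun a _ => ?_
  have ha : a ∈ IntermediateField.adjoin k (Set.range σ ∪ Set.range t) := htop ▸ trivial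
  induction ha using IntermediateField.adjoin_induction with
  | mem a ha =>
    rcases ha with ⟨r, rfl⟩ | ⟨i, rfl⟩
    · exact hK r ▸ IntermediateField.algebraMap_mem _ r
    · exact IntermediateField.subset_adjoin _ _ ⟨⟨i⟩, rfl⟩
  | algebraMap r =>
    rw [← σ.commutes r, ← hK]
    exact IntermediateField.algebraMap_mem _ _
  | add a b _ _ ha hb => exact add_mem (ha trivial) (hb trivial)
  | inv a _ ha => exact inv_mem (ha trivial)
  | mul a b _ _ ha hb => exact mul_mem (ha trivial) (hb trivial)

end PGLBundle

end

theorem mainTheorem9 {k : Type u} [Field k] [IsAlgClosed k] (n : ℕ) (hn : 0 < n)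
    (X Y : Scheme.{u}) [X.Over (Spec (.of k))] [Y.Over (Spec (.of k))]
    [PGLBundle.IsVariety k X] [PGLBundle.IsVariety k Y]
    [PGLBundle.PGLAction n (PGLBundle.points k X)]
    (γ : X ⟶ Y) [γ.IsOver (Spec (.of k))]
    (hγ : PGLBundle.IsPGLQuotient n (PGLBundle.pointsMap k γ))
    (w : ℤ) (p q j : ℕ) (hjq : j < q) (hqp : q < p)
    (P : PGLBundle.WeightedBundle n w (PGLBundle.points k X) p)
    (Q : PGLBundle.WeightedBundle n w (PGLBundle.points k X) q)
    (ZP ZQ : Scheme.{u}) [ZP.Over (Spec (.of k))] [ZQ.Over (Spec (.of k))]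
    [PGLBundle.IsVariety k ZP] [PGLBundle.IsVariety k ZQ]
    (πP : P.gr j ⟶ PGLBundle.points k ZP) (hπP : PGLBundle.IsPGLQuotient n πP)
    (πQ : Q.gr j ⟶ PGLBundle.points k ZQ) (hπQ : PGLBundle.IsPGLQuotient n πQ)
    (φP : ZP ⟶ Y) [φP.IsOver (Spec (.of k))]
    (hφP : πP ≫ PGLBundle.pointsMap k φP = P.grProj j ≫ PGLBundle.pointsMap k γ)
    (φQ : ZQ ⟶ Y) [φQ.IsOver (Spec (.of k))]
    (hφQ : πQ ≫ PGLBundle.pointsMap k φQ = Q.grProj j ≫ PGLBundle.pointsMap k γ) :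
    ∃ ρ : ZP ⤏ ZQ, PGLBundle.IsBirationallyLinear ρ ∧ ρ.compHom φQ = φP.toRationalMap := by
  let := PGLBundle.stalkAlgebra k Y (genericPoint Y)
  let := PGLBundle.stalkAlgebra k ZP (genericPoint ZP)
  let := PGLBundle.stalkAlgebra k ZQ (genericPoint ZQ)
  have : Infinite k := IsAlgClosed.instInfinite
  have : Infinite Y.functionField :=
    Infinite.of_injective _ (algebraMap k Y.functionField).injective
  have hz := PGLBundle.isGenericPoint_stalkPoint (k := k) ZP
  obtain ⟨κ, t, σ, hind, htop, hσ⟩ :=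
    PGLBundle.exists_algebraicIndependent_adjoin_eq_top (PGLBundle.isGenericPoint_stalkPoint Y)
      hγ hπP hπQ hφP hφQ hjq.le hqp.le hz
  -- The comorphism `σ` is a point of `ZQ` over the function field of `ZP`, which spreads out to a
  -- rational map.
  let z := (PGLBundle.points k ZQ).map σ (PGLBundle.stalkPoint k ZQ (genericPoint ZQ))
  have hz₁ : z.1 ≫ ZQ ↘ Spec (.of k) = ZP.fromSpecStalk _ ≫ ZP ↘ Spec (.of k) :=
    z.2.trans (Spec.map_preimage _)
  let ρ : ZP ⤏ ZQ := .ofFunctionField (ZP ↘ Spec (.of k)) (ZQ ↘ Spec (.of k)) z.1 hz₁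
  have hρ : ρ.fromFunctionField = z.1 :=
    Scheme.RationalMap.fromFunctionField_ofFunctionField _ _ _ _
  refine ⟨ρ, ⟨?_, CommRingCat.ofHom σ.hom.toRingHom, hρ.symm, ?_⟩, ?_⟩
  · have : IsLocalHom σ.hom.toRingHom :=
      PGLBundle.isLocalHom_of_field (K := ZQ.functionField) (T := .of k ZP.functionField) σ
    have hc : PGLBundle.center z = genericPoint ZQ :=
      (PGLBundle.center_map σ _).trans (PGLBundle.center_stalkPoint ZQ _)
    exact PGLBundle.isDominant_of_fromFunctionField ρ (IsLocalRing.closedPoint ZP.functionField)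
      (hρ ▸ hc)
  · exact PGLBundle.isPurelyTranscendental_of_adjoin_eq_top (K := ZQ.functionField) σ.hom t
      hind htop
  · refine Scheme.RationalMap.eq_of_fromFunctionField_eq _ _ ?_
    have h₁ : (ρ.compHom φQ).fromFunctionField = ρ.fromFunctionField ≫ φQ := by
      obtain ⟨f, hf⟩ := ρ.exists_rep
      rw [← hf]
      exact Scheme.PartialMap.fromSpecStalkOfMem_compHom f φQ _ _
    have h₂ : φP.toRationalMap.fromFunctionField = ZP.fromSpecStalk _ ≫ φP :=
      Scheme.PartialMap.fromSpecStalkOfMem_toPartialMap φP _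
    rw [h₁, hρ, h₂]
    exact congrArg Subtype.val hσ
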